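/- Let $K$ be a field of characteristic zero (for instance $K=\mathbb{C}$). For a Lie algebra $\mathfrak{h}$ over $K$ let $C(\mathfrak{h})$ be its center, $\mathrm{Der}(\mathfrak{h})$ its Lie algebra of derivations and $\mathrm{ad}(\mathfrak{h})\subseteq\mathrm{Der}(\mathfrak{h})$ the ideal of inner derivations. Call $\mathfrak{h}$ complete if it is finite-dimensional, $C(\mathfrak{h})=0$ and $\mathrm{Der}(\mathfrak{h})=\mathrm{ad}(\mathfrak{h})$. The full graph $\mathfrak{f}(\mathfrak{h})$ is the vector space $\mathrm{Der}(\mathfrak{h})\times\mathfrak{h}$ with the bracket $$[(s_1,g_1),(s_2,g_2)]=([s_1,s_2],\,s_1(g_2)-s_2(g_1)+[g_1,g_2]);$$ put $\mathfrak{f}^0(\mathfrak{h})=\mathfrak{h}$ and $\mathfrak{f}^{n}(\mathfrak{h})=\mathfrak{f}(\mathfrak{f}^{n-1}(\mathfrak{h}))$ for $n\ge 1$. **Theorem 3.** Let $\mathfrak{g}$ be a Heisenberg algebra over $K$, that is, a finite-dimensional Lie algebra with $[\mathfrak{g},\mathfrak{g}]=C(\mathfrak{g})$ and $\dim C(\mathfrak{g})=1$.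 Then for every positive integer $n$: (i) the center of $\mathfrak{f}^n(\mathfrak{g})$ is trivial; (ii) there is an isomorphism of Lie algebras $\mathrm{Der}(\mathfrak{f}^n(\mathfrak{g}))\cong\mathfrak{f}^{n-1}(\mathrm{Der}(\mathfrak{f}(\mathfrak{g})))$, and $\mathrm{Der}(\mathfrak{f}^n(\mathfrak{g}))$ is complete, but $\mathfrak{f}^n(\mathfrak{g})$ is not complete; (iii) $[\mathrm{Der}(\mathfrak{f}^n(\mathfrak{g})),\mathrm{Der}(\mathfrak{f}^n(\mathfrak{g}))]\subseteq\mathrm{ad}(\mathfrak{f}^n(\mathfrak{g}))$; (iv) $\mathfrak{f}^n(\mathfrak{g})$ is finite-dimensional and $\dim\mathrm{Der}(\mathfrak{f}^n(\mathfrak{g}))-\dim\mathfrak{f}^n(\mathfrak{g})=1$. -/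

import Mathlib

universe u

namespace CompleteLie

/-- A complete Lie algebra: finite-dimensional, with trivial center, all of whose derivations
are inner. -/
structure IsComplete (K : Type*) [Field K] (L : Type*) [LieRing L] [LieAlgebra K L] : Prop where
  finiteDimensional : FiniteDimensional K L
  center_eq_bot : LieAlgebra.center K L = ⊥
  exists_eq_ad : ∀ D : LieDerivation K L L, ∃ x : L, D = LieDerivation.ad K L x

/-- A Heisenberg algebra: a finite-dimensional Lie algebra whose derived algebra coincides with
its center, the center being one-dimensional. -/
structure IsHeisenberg (K : Type*) [Field K] (L : Type*) [LieRing L] [LieAlgebra K L] :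
    Prop where
  finiteDimensional : FiniteDimensional K L
  derived_eq_center : ⁅(⊤ : LieIdeal K L), (⊤ : LieIdeal K L)⁆ = LieAlgebra.center K L
  finrank_center : Module.finrank K (LieAlgebra.center K L) = 1

/-- The full graph of `L`: the semidirect sum of `Der L` and `L`, for the tautological action of
`Der L` on `L`. -/
abbrev FullGraph (K : Type*) [Field K] (L : Type*) [LieRing L] [LieAlgebra K L] :=
  LieAlgebra.SemiDirectSum (R := K) L (LieDerivation K L L)
    (LieHom.id : LieDerivation K L L →ₗ⁅K⁆ LieDerivation K L L)

/-- A Lie algebra bundled with its structure; used only to iterate the full graph. -/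
structure BundledLie (K : Type*) [Field K] where
  carrier : Type u
  [lieRing : LieRing carrier]
  [lieAlgebra : LieAlgebra K carrier]

attribute [instance] BundledLie.lieRing BundledLie.lieAlgebra

/-- The `n`-th iterated full graph, in bundled form: the `0`-th one is `A` itself and the
`(n + 1)`-st one is the full graph of the `n`-th one. -/
def BundledLie.iterFullGraph {K : Type*} [Field K] (A : BundledLie.{u} K) : ℕ → BundledLie.{u} K
  | 0 => A
  | n + 1 => ⟨FullGraph K (BundledLie.iterFullGraph A n).carrier⟩

/-- The `n`-th iterated full graph of `L`. -/
abbrev IterFullGraph (K : Type*) [Field K] (L : Type u) [LieRing L] [LieAlgebra K L] (n : ℕ) :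
    Type u :=
  (BundledLie.iterFullGraph (⟨L⟩ : BundledLie.{u} K) n).carrier

end CompleteLie

/-!
Write `𝔣 L = Der L ⋉ L`. The proof has two independent halves.

*From `L` to `𝔣 L`.* For a centerless Lie algebra `L`, the map `(D, x) ↦ (D + ad x, D)`
(`FullGraph.toSquare`) embeds `𝔣 L` in `Der L × Der L`; the image consists of the pairs that agree
modulo `ad L`. In it the ideals `L × 0` and `0 × L` are the centralizers of each other, so every
derivation of `𝔣 L` preserves both and is determined by the two derivations of `L` it induces. If
moreover `[Der L, Der L] ⊆ ad L`, the image is an ideal of `Der L × Der L` and every such pair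
occurs: `Der (𝔣 L) ≃ Der L × Der L` (`FullGraph.squareEquiv`). When `P` is complete, the same
embedding gives `𝔣 P ≃ P × P`, and `𝔣 P` is complete. Hence `Der (𝔣 L) ≃ 𝔣 (Der L)` whenever
`Der L` is complete, and the list of properties `IsAlmostComplete` passes from `L` to `𝔣 L`
(`IsAlmostComplete.fullGraph`). The theorem is thereby reduced to the first full graph.

*The first full graph of a Heisenberg algebra `L`.* Let `L = W ⊕ K c` with `[x, y] = ω(x, y) c`, and
let `E` be the derivation equal to `1` on `W` and `2` on `c`. Then `ad (E, 0)` grades `𝔣 L` in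
degrees `0, 1, 2`: degree zero consists of the derivations commuting with `E`, degree two of
`K c`, and degree one of two copies of `W`, namely `x ↦ (0, x)` and `x ↦ (ad x, 0)`. The map
`(D, x) ↦ (ad x, -2 x)` is a derivation, and it is outer; `outerDer` is its sum with `ad (E, 0)`.
Both `Der (𝔣 L) = ad (𝔣 L) ⊕ K outerDer` and the completeness of `Der (𝔣 L)` amount to one
cohomological statement: every derivation of `𝔣 L` with values in the span of `ad (𝔣 L)` and
`outerDer` is the bracket with an element of that span (`IsTwistedDer.exists_eq`). To prove it, one
first makes the derivation homogeneous of degree zero by subtracting a bracket. Its `2 × 2` matrix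
on the degree one part then commutes with the symplectic transvections of `W` up to scalars and
up to a common diagonal term, so that a version of Schur's lemma (`exists_scalar`) determines all
its entries up to scalars and one endomorphism of `W`; the brackets in degree two pin down these
scalars. No structure theory of the symplectic Lie algebra is needed.
-/

namespace CompleteLie

/-! ### Ideals, derivations and completeness -/

section General

variable {K : Type*} [Field K] {L : Type*} [LieRing L] [LieAlgebra K L]
  {M : Type*} [LieRing M] [LieAlgebra K M]

lemma center_eq_bot_iff :
    LieAlgebra.center K L = ⊥ ↔ ∀ x : L, (∀ y : L, ⁅x, y⁆ = 0) → x = 0 := by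
  rw [LieSubmodule.eq_bot_iff]
  refine forall_congr' fun x => imp_congr_left ?_
  rw [LieModule.mem_maxTrivSubmodule]
  refine forall_congr' fun y => ?_
  rw [← lie_skew, neg_eq_zero]

/-- The derivation of `L` induced by a derivation `D` of `M` that preserves the image of an
injective homomorphism `L → M`. -/
noncomputable def pullbackDer (j : L →ₗ⁅K⁆ M) (hj : Function.Injective j)
    (D : LieDerivation K M M) (hD : ∀ x, ∃ y, j y = D (j x)) : LieDerivation K L L where
  toFun x := (hD x).choose
  map_add' x y := hj <| (hD _).choose_spec.trans <| by
    simp only [map_add, fun x => (hD x).choose_spec]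
  map_smul' t x := hj <| (hD _).choose_spec.trans <| by
    simp only [map_smul, fun x => (hD x).choose_spec, RingHom.id_apply]
  leibniz' x y := hj <| (hD _).choose_spec.trans <| by
    change _ = j (⁅x, (hD y).choose⁆ - ⁅y, (hD x).choose⁆)
    simp only [map_sub, LieHom.map_lie, fun x => (hD x).choose_spec,
      LieDerivation.apply_lie_eq_sub]

lemma pullbackDer_spec (j : L →ₗ⁅K⁆ M) (hj : Function.Injective j)
    (D : LieDerivation K M M) (hD : ∀ x, ∃ y, j y = D (j x)) (x : L) :
    j (pullbackDer j hj D hD x) = D (j x) :=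
  (hD x).choose_spec

/-- The action of `M` by derivations on `L`, when `j` embeds `L` in `M` as an ideal. -/
noncomputable def idealAction (j : L →ₗ⁅K⁆ M) (hj : Function.Injective j)
    (hI : ∀ (q : M) (x : L), ∃ y, j y = ⁅q, j x⁆) : M →ₗ⁅K⁆ LieDerivation K L L where
  toFun q := pullbackDer j hj (LieDerivation.ad K M q) fun x => by simpa using hI q x
  map_add' p q := by
    ext x
    apply hj
    simp [pullbackDer_spec]
  map_smul' t q := by
    ext x
    apply hj
    simp [pullbackDer_spec]
  map_lie' {p q} := by
    ext x
    apply hj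
    simp [pullbackDer_spec]

lemma idealAction_spec (j : L →ₗ⁅K⁆ M) (hj : Function.Injective j)
    (hI : ∀ (q : M) (x : L), ∃ y, j y = ⁅q, j x⁆) (q : M) (x : L) :
    j (idealAction j hj hI q x) = ⁅q, j x⁆ := by
  change j (pullbackDer j hj _ _ x) = _
  simp [pullbackDer_spec]

lemma IsComplete.congr (e : L ≃ₗ⁅K⁆ M) (h : IsComplete K L) : IsComplete K M where
  finiteDimensional :=
    have := h.finiteDimensional
    e.toLinearEquiv.finiteDimensional
  center_eq_bot := by
    rw [center_eq_bot_iff]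
    intro x hx
    have := center_eq_bot_iff.1 h.center_eq_bot (e.symm x) fun y => by
      apply e.injective
      simp [hx]
    simpa using this
  exists_eq_ad D := by
    obtain ⟨x, hx⟩ := h.exists_eq_ad (pullbackDer e.toLieHom e.injective D fun x =>
      ⟨e.symm (D (e x)), by simp⟩)
    refine ⟨e x, ?_⟩
    ext y
    have h1 := pullbackDer_spec e.toLieHom e.injective D (fun x =>
      ⟨e.symm (D (e x)), by simp⟩) (e.symm y)
    rw [hx] at h1
    simpa using h1.symm

lemma center_der_eq_bot (h : LieAlgebra.center K L = ⊥) :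
    LieAlgebra.center K (LieDerivation K L L) = ⊥ := by
  rw [center_eq_bot_iff]
  intro D hD
  ext x
  apply LieDerivation.injective_ad_of_center_eq_bot h
  rw [← LieDerivation.lie_der_ad_eq_ad_der, hD]
  simp

/-- A derivation that commutes with all inner derivations of a centerless Lie algebra is zero. -/
lemma der_eq_zero_of_lie_ad (h : LieAlgebra.center K L = ⊥) {D : LieDerivation K L L}
    (hD : ∀ x, ⁅D, LieDerivation.ad K L x⁆ = 0) : D = 0 := by
  ext x
  apply LieDerivation.injective_ad_of_center_eq_bot h
  rw [← LieDerivation.lie_der_ad_eq_ad_der, hD]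
  simp

end General

/-! ### The full graph of a centerless Lie algebra -/

namespace FullGraph

variable {K : Type*} [Field K] {L : Type*} [LieRing L] [LieAlgebra K L]

@[simp] lemma left_add (u v : FullGraph K L) : (u + v).left = u.left + v.left := rfl
@[simp] lemma right_add (u v : FullGraph K L) : (u + v).right = u.right + v.right := rfl
@[simp] lemma left_sub (u v : FullGraph K L) : (u - v).left = u.left - v.left := rfl
@[simp] lemma right_sub (u v : FullGraph K L) : (u - v).right = u.right - v.right := rfl
@[simp] lemma left_smul (t : K) (u : FullGraph K L) : (t • u).left = t • u.left := rfl
@[simp] lemma right_smul (t : K) (u : FullGraph K L) : (t • u).right = t • u.right := rfl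
@[simp] lemma left_zero : (0 : FullGraph K L).left = 0 := rfl
@[simp] lemma right_zero : (0 : FullGraph K L).right = 0 := rfl
lemma left_lie (u v : FullGraph K L) :
    ⁅u, v⁆.left = ⁅u.left, v.left⁆ + u.right v.left - v.right u.left := rfl
@[simp] lemma right_lie (u v : FullGraph K L) : ⁅u, v⁆.right = ⁅u.right, v.right⁆ := rfl

/-- The homomorphism `(D, x) ↦ D + ad x` from the full graph to the derivations. -/
def sumHom : FullGraph K L →ₗ⁅K⁆ LieDerivation K L L where
  toFun u := u.right + LieDerivation.ad K L u.left
  map_add' u v := by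
    simp only [left_add, right_add, map_add]
    abel
  map_smul' t u := by
    simp only [left_smul, right_smul, map_smul, smul_add, RingHom.id_apply]
  map_lie' {u v} := by
    simp only [left_lie, right_lie, map_add, map_sub, LieHom.map_lie, add_lie, lie_add,
      LieDerivation.lie_der_ad_eq_ad_der]
    rw [← lie_skew (LieDerivation.ad K L u.left) v.right, LieDerivation.lie_der_ad_eq_ad_der]
    abel

lemma sumHom_apply (u : FullGraph K L) :
    sumHom u = u.right + LieDerivation.ad K L u.left := rfl

/-- The embedding `(D, x) ↦ (D + ad x, D)` of the full graph of a centerless Lie algebra into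
the square of its algebra of derivations. -/
def toSquare : FullGraph K L →ₗ⁅K⁆ LieDerivation K L L × LieDerivation K L L :=
  sumHom.prod (LieAlgebra.SemiDirectSum.projr _)

@[simp] lemma toSquare_fst (u : FullGraph K L) : (toSquare u).1 = sumHom u := rfl
@[simp] lemma toSquare_snd (u : FullGraph K L) : (toSquare u).2 = u.right := rfl

variable (K) in
/-- The second copy `x ↦ (ad x, -x)` of `L` in its full graph; it commutes with the first. -/
def rightCopy : L →ₗ⁅K⁆ FullGraph K L where
  toFun x := ⟨-x, LieDerivation.ad K L x⟩
  map_add' x y := by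
    ext1 <;> simp [neg_add_rev, add_comm]
  map_smul' t x := by
    ext1 <;> simp
  map_lie' {x y} := by
    ext1 <;> simp

variable (K) in
/-- The first copy of `L` in its full graph. -/
abbrev leftCopy : L →ₗ⁅K⁆ FullGraph K L := LieAlgebra.SemiDirectSum.inl _

@[simp] lemma left_rightCopy (x : L) : (rightCopy K x).left = -x := rfl
@[simp] lemma right_rightCopy (x : L) : (rightCopy K x).right = LieDerivation.ad K L x := rfl
@[simp] lemma left_leftCopy (x : L) : (leftCopy K x).left = x := rfl
@[simp] lemma right_leftCopy (x : L) : (leftCopy K x).right = 0 := rfl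

lemma toSquare_leftCopy (x : L) :
    toSquare (leftCopy K x) = (LieDerivation.ad K L x, 0) := by
  ext1 <;> simp only [toSquare_fst, toSquare_snd, sumHom_apply, left_leftCopy, right_leftCopy,
    zero_add]

lemma toSquare_rightCopy (x : L) :
    toSquare (rightCopy K x) = (0, LieDerivation.ad K L x) := by
  ext1 <;> simp only [toSquare_fst, toSquare_snd, sumHom_apply, left_rightCopy, right_rightCopy,
    map_neg, add_neg_cancel]

lemma lie_leftCopy_rightCopy (x y : L) : ⁅leftCopy K x, rightCopy K y⁆ = 0 := by
  ext1 <;> simp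

lemma lie_leftCopy (u : FullGraph K L) (x : L) : ⁅u, leftCopy K x⁆ = leftCopy K (sumHom u x) := by
  ext1
  · simp only [left_lie, left_leftCopy, right_leftCopy, sumHom_apply]
    simp [add_comm]
  · simp

lemma lie_rightCopy (u : FullGraph K L) (x : L) : ⁅u, rightCopy K x⁆ = rightCopy K (u.right x) := by
  ext1
  · simp
  · simp [LieDerivation.lie_der_ad_eq_ad_der, -LieDerivation.coe_ad_apply_eq_ad_apply]

lemma leftCopy_injective : Function.Injective (leftCopy K : L →ₗ⁅K⁆ FullGraph K L) :=
  LieAlgebra.SemiDirectSum.inl_injective _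

lemma rightCopy_injective : Function.Injective (rightCopy K : L →ₗ⁅K⁆ FullGraph K L) :=
  fun x y h => by simpa using congrArg LieAlgebra.SemiDirectSum.left h

lemma finrank_eq [FiniteDimensional K L] :
    FiniteDimensional K (FullGraph K L) ∧ Module.finrank K (FullGraph K L) =
      Module.finrank K (LieDerivation K L L) + Module.finrank K L := by
  have e := (LieAlgebra.SemiDirectSum.toProdl
    (LieHom.id : LieDerivation K L L →ₗ⁅K⁆ LieDerivation K L L))
  refine ⟨e.symm.finiteDimensional, ?_⟩
  rw [e.finrank_eq, Module.finrank_prod, add_comm]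

section Centerless

variable (hc : LieAlgebra.center K L = ⊥)
include hc

lemma toSquare_injective : Function.Injective (toSquare : FullGraph K L →ₗ⁅K⁆ _) := by
  rw [injective_iff_map_eq_zero]
  intro u hu
  have h2 : u.right = 0 := congrArg Prod.snd hu
  have h1 : sumHom u = 0 := congrArg Prod.fst hu
  rw [sumHom_apply, h2, zero_add] at h1
  ext1
  · exact LieDerivation.injective_ad_of_center_eq_bot hc (by rw [h1]; simp)
  · exact h2

/-- An element of the full graph of a centerless Lie algebra commuting with the first copy of
`L` lies in the second copy. -/
lemma exists_rightCopy_of_lie_leftCopy {u : FullGraph K L} (hu : ∀ x : L, ⁅u, leftCopy K x⁆ = 0) :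
    ∃ y, rightCopy K y = u := by
  refine ⟨-u.left, toSquare_injective hc ?_⟩
  have h : sumHom u = 0 := by
    ext x
    have := hu x
    rw [lie_leftCopy] at this
    exact congrArg LieAlgebra.SemiDirectSum.left this
  rw [toSquare_rightCopy, Prod.ext_iff]
  refine ⟨h.symm, ?_⟩
  rw [sumHom_apply] at h
  rw [toSquare_snd, map_neg, eq_neg_of_add_eq_zero_left h]

omit hc in
lemma exists_leftCopy_of_lie_rightCopy {u : FullGraph K L} (hu : ∀ x : L, ⁅u, rightCopy K x⁆ = 0) :
    ∃ y, leftCopy K y = u := by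
  refine ⟨u.left, ?_⟩
  ext1
  · rfl
  ext x
  have := hu x
  rw [lie_rightCopy, ← map_zero (rightCopy K : L →ₗ⁅K⁆ FullGraph K L)] at this
  simp [rightCopy_injective this]

lemma eq_zero_of_lie {u : FullGraph K L} (h1 : ∀ x : L, ⁅u, leftCopy K x⁆ = 0)
    (h2 : ∀ x : L, ⁅u, rightCopy K x⁆ = 0) : u = 0 := by
  obtain ⟨y, rfl⟩ := exists_leftCopy_of_lie_rightCopy h2
  rw [← map_zero (leftCopy K : L →ₗ⁅K⁆ FullGraph K L)]
  congr 1
  refine center_eq_bot_iff.1 hc y fun x => leftCopy_injective (K := K) ?_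
  rw [LieHom.map_lie, h1, map_zero]

lemma center_eq_bot : LieAlgebra.center K (FullGraph K L) = ⊥ :=
  center_eq_bot_iff.2 fun _ hu => eq_zero_of_lie hc (fun _ => hu _) (fun _ => hu _)

/-- The full graph of a complete Lie algebra is the product of two copies of it. -/
lemma nonempty_equiv_square (h : IsComplete K L) : Nonempty (FullGraph K L ≃ₗ⁅K⁆ L × L) := by
  have had : Function.Bijective (LieDerivation.ad K L) :=
    ⟨LieDerivation.injective_ad_of_center_eq_bot hc,
      fun D => (h.exists_eq_ad D).imp fun _ => Eq.symm⟩
  have hb : Function.Bijective ((LieDerivation.ad K L).prodMap (LieDerivation.ad K L)) :=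
    Function.Bijective.prodMap had had
  have ht : Function.Bijective (toSquare : FullGraph K L →ₗ⁅K⁆ _) := by
    refine ⟨toSquare_injective hc, fun p => ?_⟩
    obtain ⟨⟨x, y⟩, rfl⟩ := hb.2 p
    refine ⟨leftCopy K x + rightCopy K y, ?_⟩
    rw [map_add, toSquare_leftCopy, toSquare_rightCopy]
    simp
  exact ⟨(LieEquiv.ofBijective _ ht).trans (LieEquiv.ofBijective _ hb).symm⟩

variable (hD : ∀ D D' : LieDerivation K L L, ∃ x, LieDerivation.ad K L x = ⁅D, D'⁆)

omit hc in
include hD in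
lemma toSquare_ideal (p : LieDerivation K L L × LieDerivation K L L) (u : FullGraph K L) :
    ∃ v, toSquare v = ⁅p, toSquare u⁆ := by
  obtain ⟨x, hx⟩ := hD p.1 (sumHom u)
  obtain ⟨y, hy⟩ := hD p.2 u.right
  refine ⟨leftCopy K x + rightCopy K y, ?_⟩
  rw [map_add, toSquare_leftCopy, toSquare_rightCopy, hx, hy]
  simp

/-- If `Der L` is abelian modulo inner derivations, then `Der L × Der L` acts by derivations on
the full graph of `L`, embedded in it as an ideal. -/
noncomputable def squareAction :
    LieDerivation K L L × LieDerivation K L L →ₗ⁅K⁆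
      LieDerivation K (FullGraph K L) (FullGraph K L) :=
  idealAction toSquare (toSquare_injective hc) (toSquare_ideal hD)

lemma squareAction_spec (p : LieDerivation K L L × LieDerivation K L L) (u : FullGraph K L) :
    toSquare (squareAction hc hD p u) = ⁅p, toSquare u⁆ :=
  idealAction_spec _ _ _ _ _

lemma squareAction_leftCopy (p : LieDerivation K L L × LieDerivation K L L) (x : L) :
    squareAction hc hD p (leftCopy K x) = leftCopy K (p.1 x) := by
  apply toSquare_injective hc
  rw [squareAction_spec, toSquare_leftCopy, toSquare_leftCopy, LieAlgebra.Prod.bracket_apply,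
    LieDerivation.lie_der_ad_eq_ad_der]
  simp

lemma squareAction_rightCopy (p : LieDerivation K L L × LieDerivation K L L) (x : L) :
    squareAction hc hD p (rightCopy K x) = rightCopy K (p.2 x) := by
  apply toSquare_injective hc
  rw [squareAction_spec, toSquare_rightCopy, toSquare_rightCopy, LieAlgebra.Prod.bracket_apply,
    LieDerivation.lie_der_ad_eq_ad_der]
  simp

lemma squareAction_toSquare (u : FullGraph K L) :
    squareAction hc hD (toSquare u) = LieDerivation.ad K _ u := by
  ext1 v
  apply toSquare_injective hc
  rw [squareAction_spec, ← LieHom.map_lie]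
  simp

lemma squareAction_injective : Function.Injective (squareAction hc hD) := by
  rw [injective_iff_map_eq_zero]
  intro p hp
  ext x
  · apply leftCopy_injective (K := K)
    rw [← squareAction_leftCopy hc hD, hp]
    simp
  · apply rightCopy_injective (K := K)
    rw [← squareAction_rightCopy hc hD, hp]
    simp

/-- The two copies of `L` in the full graph are mutual centralizers, so every derivation
preserves both. -/
lemma der_leftCopy_rightCopy (d : LieDerivation K (FullGraph K L) (FullGraph K L)) (x y : L) :
    ⁅d (leftCopy K x), rightCopy K y⁆ = 0 ∧ ⁅d (rightCopy K y), leftCopy K x⁆ = 0 := by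
  have h : ⁅leftCopy K x, d (rightCopy K y)⁆ + ⁅d (leftCopy K x), rightCopy K y⁆ = 0 := by
    rw [← LieDerivation.apply_lie_eq_add, lie_leftCopy_rightCopy, map_zero]
  rw [← lie_skew, lie_leftCopy, lie_rightCopy] at h
  have h2 : (d (leftCopy K x)).right y = 0 := by
    have := congrArg LieAlgebra.SemiDirectSum.right h
    rw [right_add, ← map_neg, right_leftCopy, zero_add, right_rightCopy, right_zero] at this
    exact LieDerivation.injective_ad_of_center_eq_bot hc (this.trans (map_zero _).symm)
  rw [lie_rightCopy, lie_leftCopy, h2, map_zero]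
  rw [h2, map_zero, add_zero, neg_eq_zero] at h
  exact ⟨rfl, h⟩

lemma squareAction_surjective : Function.Surjective (squareAction hc hD) := by
  intro d
  have h1 : ∀ x, ∃ y, leftCopy K y = d (leftCopy K x) := fun x =>
    exists_leftCopy_of_lie_rightCopy fun y => (der_leftCopy_rightCopy hc d x y).1
  have h2 : ∀ x, ∃ y, rightCopy K y = d (rightCopy K x) := fun x =>
    exists_rightCopy_of_lie_leftCopy hc fun y => (der_leftCopy_rightCopy hc d y x).2
  refine ⟨(pullbackDer (leftCopy K) leftCopy_injective d h1,
    pullbackDer (rightCopy K) rightCopy_injective d h2), ?_⟩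
  rw [← sub_eq_zero]
  set d' := squareAction hc hD
    (pullbackDer (leftCopy K) leftCopy_injective d h1,
      pullbackDer (rightCopy K) rightCopy_injective d h2) - d with hd'
  have hl : ∀ x, d' (leftCopy K x) = 0 := fun x => by
    rw [hd', LieDerivation.sub_apply, squareAction_leftCopy, pullbackDer_spec, sub_self]
  have hr : ∀ x, d' (rightCopy K x) = 0 := fun x => by
    rw [hd', LieDerivation.sub_apply, squareAction_rightCopy, pullbackDer_spec, sub_self]
  -- `d'` kills both copies of `L`, which are ideals; so its values centralize both of them
  ext1 u
  refine eq_zero_of_lie hc (fun x => ?_) (fun x => ?_)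
  · have := d'.apply_lie_eq_add u (leftCopy K x)
    rw [lie_leftCopy, hl, hl, lie_zero, zero_add] at this
    exact this.symm
  · have := d'.apply_lie_eq_add u (rightCopy K x)
    rw [lie_rightCopy, hr, hr, lie_zero, zero_add] at this
    exact this.symm

/-- `Der (𝔣 L) ≃ Der L × Der L`. -/
noncomputable def squareEquiv :
    (LieDerivation K L L × LieDerivation K L L) ≃ₗ⁅K⁆
      LieDerivation K (FullGraph K L) (FullGraph K L) :=
  LieEquiv.ofBijective (squareAction hc hD)
    ⟨squareAction_injective hc hD, squareAction_surjective hc hD⟩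

omit hc in
lemma isComplete (h : IsComplete K L) : IsComplete K (FullGraph K L) where
  finiteDimensional :=
    have := h.finiteDimensional
    finrank_eq.1
  center_eq_bot := center_eq_bot h.center_eq_bot
  exists_eq_ad d := by
    obtain ⟨p, rfl⟩ := squareAction_surjective h.center_eq_bot
      (fun D D' => (h.exists_eq_ad _).imp fun _ => Eq.symm) d
    obtain ⟨x, hx⟩ := h.exists_eq_ad p.1
    obtain ⟨y, hy⟩ := h.exists_eq_ad p.2
    refine ⟨leftCopy K x + rightCopy K y, ?_⟩
    rw [← squareAction_toSquare h.center_eq_bot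
      (fun D D' => (h.exists_eq_ad _).imp fun _ => Eq.symm), map_add toSquare,
      toSquare_leftCopy, toSquare_rightCopy, ← hx, ← hy]
    simp

end Centerless

end FullGraph

/-! ### Induction along the iterated full graphs -/

/-- The properties common to all the iterated full graphs of a Heisenberg algebra: the derivation
algebra is complete, and the algebra is embedded in it as an ideal of codimension one. -/
structure IsAlmostComplete (K : Type*) [Field K] (L : Type*) [LieRing L] [LieAlgebra K L] :
    Prop where
  finiteDimensional : FiniteDimensional K L
  center_eq_bot : LieAlgebra.center K L = ⊥
  exists_ad_eq_lie : ∀ D D' : LieDerivation K L L, ∃ x, LieDerivation.ad K L x = ⁅D, D'⁆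
  isComplete_der : IsComplete K (LieDerivation K L L)
  finrank_der : Module.finrank K (LieDerivation K L L) = Module.finrank K L + 1

section Induction

variable {K : Type*} [Field K] {L : Type*} [LieRing L] [LieAlgebra K L]
  {M : Type*} [LieRing M] [LieAlgebra K M]

lemma FullGraph.nonempty_congr (hL : IsComplete K L) (e : L ≃ₗ⁅K⁆ M) :
    Nonempty (FullGraph K L ≃ₗ⁅K⁆ FullGraph K M) := by
  have hM := hL.congr e
  obtain ⟨f⟩ := nonempty_equiv_square hL.center_eq_bot hL
  obtain ⟨g⟩ := nonempty_equiv_square hM.center_eq_bot hM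
  exact ⟨(f.trans (LieEquiv.ofBijective (e.toLieHom.prodMap e.toLieHom)
    (Function.Bijective.prodMap e.bijective e.bijective))).trans g.symm⟩

namespace IsAlmostComplete

lemma nonempty_der_fullGraph_equiv (h : IsAlmostComplete K L) :
    Nonempty (LieDerivation K (FullGraph K L) (FullGraph K L) ≃ₗ⁅K⁆
      FullGraph K (LieDerivation K L L)) := by
  obtain ⟨f⟩ := FullGraph.nonempty_equiv_square h.isComplete_der.center_eq_bot h.isComplete_der
  exact ⟨(FullGraph.squareEquiv h.center_eq_bot h.exists_ad_eq_lie).symm.trans f.symm⟩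

lemma fullGraph (h : IsAlmostComplete K L) : IsAlmostComplete K (FullGraph K L) := by
  have := h.finiteDimensional
  refine ⟨FullGraph.finrank_eq.1, FullGraph.center_eq_bot h.center_eq_bot, fun d d' => ?_, ?_, ?_⟩
  · obtain ⟨p, rfl⟩ := FullGraph.squareAction_surjective h.center_eq_bot h.exists_ad_eq_lie d
    obtain ⟨q, rfl⟩ := FullGraph.squareAction_surjective h.center_eq_bot h.exists_ad_eq_lie d'
    obtain ⟨x, hx⟩ := h.exists_ad_eq_lie p.1 q.1
    obtain ⟨y, hy⟩ := h.exists_ad_eq_lie p.2 q.2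
    refine ⟨FullGraph.leftCopy K x + FullGraph.rightCopy K y, ?_⟩
    rw [← FullGraph.squareAction_toSquare h.center_eq_bot h.exists_ad_eq_lie, ← LieHom.map_lie,
      map_add FullGraph.toSquare, FullGraph.toSquare_leftCopy, FullGraph.toSquare_rightCopy, hx, hy]
    simp
  · obtain ⟨e⟩ := h.nonempty_der_fullGraph_equiv
    exact (FullGraph.isComplete h.isComplete_der).congr e.symm
  · have := h.isComplete_der.finiteDimensional
    rw [← (FullGraph.squareEquiv h.center_eq_bot h.exists_ad_eq_lie).toLinearEquiv.finrank_eq,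
      Module.finrank_prod, FullGraph.finrank_eq.2, h.finrank_der]
    ring

lemma not_isComplete (h : IsAlmostComplete K L) : ¬ IsComplete K L := fun hL => by
  have := h.finiteDimensional
  have hs : Function.Surjective (LieDerivation.ad K L).toLinearMap :=
    fun D => (hL.exists_eq_ad D).imp fun _ => Eq.symm
  have := LinearMap.finrank_le_finrank_of_surjective hs
  have := h.finrank_der
  omega

lemma lie_top_le_range_ad (h : IsAlmostComplete K L) :
    (⁅(⊤ : LieIdeal K (LieDerivation K L L)),
      (⊤ : LieIdeal K (LieDerivation K L L))⁆).toSubmodule ≤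
      (LieDerivation.ad K L).range.toSubmodule := by
  rw [LieSubmodule.lieIdeal_oper_eq_linear_span, Submodule.span_le]
  rintro _ ⟨⟨D, -⟩, ⟨D', -⟩, rfl⟩
  exact h.exists_ad_eq_lie D D'

end IsAlmostComplete

/-- If the first full graph of `L` has a complete derivation algebra of dimension one more, then
so have all the later ones, and taking derivations commutes with taking further full graphs. -/
lemma IsAlmostComplete.iterFullGraph {K : Type*} [Field K] {L : Type*} [LieRing L]
    [LieAlgebra K L] (h : IsAlmostComplete K (FullGraph K L)) (n : ℕ) :
    IsAlmostComplete K (IterFullGraph K L (n + 1)) ∧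
    Nonempty (LieDerivation K (IterFullGraph K L (n + 1)) (IterFullGraph K L (n + 1)) ≃ₗ⁅K⁆
      IterFullGraph K (LieDerivation K (FullGraph K L) (FullGraph K L)) n) := by
  induction n with
  | zero => exact ⟨h, ⟨LieEquiv.refl⟩⟩
  | succ n ih =>
    obtain ⟨h1, ⟨e⟩⟩ := ih
    obtain ⟨f⟩ := h1.nonempty_der_fullGraph_equiv
    obtain ⟨g⟩ := FullGraph.nonempty_congr h1.isComplete_der e
    exact ⟨h1.fullGraph, ⟨f.trans g⟩⟩

end Induction

/-! ### Heisenberg algebras and their derivations -/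

/-- A normal form for Heisenberg algebras: a generator `c` of the center, and a linear form
`coord` with `coord c = 1`. The kernel of `coord` is a complement of the center, on which
`(x, y) ↦ coord ⁅x, y⁆` is a symplectic form. -/
structure HeisenbergData (K : Type*) [Field K] (L : Type*) [LieRing L] [LieAlgebra K L] where
  c : L
  coord : L →ₗ[K] K
  c_lie : ∀ x : L, ⁅c, x⁆ = 0
  lie_eq : ∀ x y : L, ⁅x, y⁆ = coord ⁅x, y⁆ • c
  coord_c : coord c = 1
  eq_of_lie_eq_zero : ∀ x : L, (∀ y : L, ⁅x, y⁆ = 0) → x = coord x • c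
  exists_lie_ne_zero : ∃ x y : L, ⁅x, y⁆ ≠ 0

section

variable {K : Type*} [Field K] {L : Type*} [LieRing L] [LieAlgebra K L]

lemma IsHeisenberg.nonempty_data (h : IsHeisenberg K L) : Nonempty (HeisenbergData K L) := by
  obtain ⟨c, hc0, hc⟩ := finrank_eq_one_iff'.1 h.finrank_center
  have hc0' : (c : L) ≠ 0 := fun h0 => hc0 (Subtype.ext h0)
  obtain ⟨f, hf⟩ := Module.Projective.exists_dual_ne_zero K hc0'
  have hmem : ∀ z ∈ LieAlgebra.center K L, ∃ t : K, t • (c : L) = z := fun z hz => by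
    obtain ⟨t, ht⟩ := hc ⟨z, hz⟩
    exact ⟨t, congrArg Subtype.val ht⟩
  have hcoord : ∀ z ∈ LieAlgebra.center K L, z = ((f c)⁻¹ • f) z • (c : L) := fun z hz => by
    obtain ⟨t, rfl⟩ := hmem z hz
    rw [LinearMap.smul_apply, map_smul, smul_eq_mul, smul_eq_mul]
    congr 1
    field_simp
  have hcen : ∀ x : L, (∀ y : L, ⁅x, y⁆ = 0) → x ∈ LieAlgebra.center K L := fun x hx => by
    rw [LieModule.mem_maxTrivSubmodule]
    intro y
    rw [← lie_skew, hx, neg_zero]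
  refine ⟨⟨c, (f c)⁻¹ • f, fun x => ?_, fun x y => hcoord _ ?_, ?_,
    fun x hx => hcoord _ (hcen x hx), ?_⟩⟩
  · rw [← lie_skew, (LieModule.mem_maxTrivSubmodule K L L _).1 c.2, neg_zero]
  · rw [← h.derived_eq_center]
    exact LieSubmodule.lie_mem_lie trivial trivial
  · simp [inv_mul_cancel₀ hf]
  · by_contra! hab
    have : LieAlgebra.center K L = ⊥ := by
      rw [← h.derived_eq_center, eq_bot_iff, LieSubmodule.lie_le_iff]
      intro x _ y _
      simp [hab]
    apply hc0'
    have h2 : (c : L) ∈ (⊥ : LieIdeal K L) := this ▸ c.2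
    simpa using h2

namespace HeisenbergData

variable (S : HeisenbergData K L)

lemma lie_c (x : L) : ⁅x, S.c⁆ = 0 := by rw [← lie_skew, S.c_lie, neg_zero]

include S in
lemma lie_lie_left (x y z : L) : ⁅⁅x, y⁆, z⁆ = 0 := by
  rw [S.lie_eq x y, smul_lie, S.c_lie, smul_zero]

include S in
lemma lie_lie_right (x y z : L) : ⁅x, ⁅y, z⁆⁆ = 0 := by
  rw [← lie_skew, S.lie_lie_left, neg_zero]

lemma coord_sub_self (x : L) : S.coord (x - S.coord x • S.c) = 0 := by
  simp [S.coord_c]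

/-- Nondegeneracy of the symplectic form. -/
lemma exists_lie_eq_c {v : L} (hv : S.coord v = 0) (hv0 : v ≠ 0) :
    ∃ w, S.coord w = 0 ∧ ⁅v, w⁆ = S.c := by
  obtain ⟨y, hy⟩ : ∃ y : L, ⁅v, y⁆ ≠ 0 := by
    by_contra! h
    exact hv0 (by rw [S.eq_of_lie_eq_zero v h, hv, zero_smul])
  have hy' : S.coord ⁅v, y⁆ ≠ 0 := fun h => hy (by rw [S.lie_eq, h, zero_smul])
  refine ⟨(S.coord ⁅v, y⁆)⁻¹ • (y - S.coord y • S.c), by simp [S.coord_c], ?_⟩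
  rw [lie_smul, lie_sub, lie_smul, S.lie_c, smul_zero, sub_zero]
  nth_rewrite 2 [S.lie_eq]
  rw [smul_smul, inv_mul_cancel₀ hy', one_smul]

lemma exists_pair : ∃ x y : L, S.coord x = 0 ∧ S.coord y = 0 ∧ ⁅x, y⁆ = S.c := by
  obtain ⟨x, y, hxy⟩ := S.exists_lie_ne_zero
  have h0 : x - S.coord x • S.c ≠ 0 := fun h => hxy (by
    rw [sub_eq_zero.1 h, smul_lie, S.c_lie, smul_zero])
  obtain ⟨w, hw, h⟩ := S.exists_lie_eq_c (S.coord_sub_self x) h0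
  exact ⟨_, w, S.coord_sub_self x, hw, h⟩

lemma c_ne_zero : S.c ≠ 0 := fun h => by simpa [h] using S.coord_c

lemma eq_of_ad_eq {v w : L} (hv : S.coord v = 0) (hw : S.coord w = 0)
    (h : LieDerivation.ad K L v = LieDerivation.ad K L w) : v = w := by
  rw [← sub_eq_zero]
  rw [S.eq_of_lie_eq_zero (v - w) fun y => ?_]
  · simp [hv, hw]
  · have := LieDerivation.congr_fun h y
    rw [sub_lie, sub_eq_zero]
    simpa using this

/-- Every linear form that vanishes on the center is represented by the symplectic form. -/
lemma exists_rep [FiniteDimensional K L] (f : L →ₗ[K] K) (hf : f S.c = 0) :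
    ∃ w, S.coord w = 0 ∧ ∀ x, ⁅w, x⁆ = f x • S.c := by
  let ω : L →ₗ[K] Module.Dual K L :=
    LinearMap.mk₂ K (fun x y => S.coord ⁅x, y⁆) (by simp) (by simp) (by simp) (by simp)
  have hω : ∀ x y, ω x y = S.coord ⁅x, y⁆ := fun _ _ => rfl
  have hker : LinearMap.ker ω = K ∙ S.c := by
    ext x
    rw [LinearMap.mem_ker, Submodule.mem_span_singleton]
    constructor
    · intro h
      refine ⟨S.coord x, (S.eq_of_lie_eq_zero x fun y => ?_).symm⟩
      rw [S.lie_eq, ← hω, h, LinearMap.zero_apply, zero_smul]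
    · rintro ⟨t, rfl⟩
      ext y
      rw [hω, smul_lie, S.c_lie]
      simp
  have hran : LinearMap.range ω = (K ∙ S.c).dualAnnihilator := by
    apply Submodule.eq_of_le_of_finrank_eq
    · rintro _ ⟨x, rfl⟩
      rw [Submodule.mem_dualAnnihilator]
      intro y hy
      obtain ⟨t, rfl⟩ := Submodule.mem_span_singleton.1 hy
      rw [hω, lie_smul, S.lie_c]
      simp
    · have h1 := LinearMap.finrank_range_add_finrank_ker ω
      have h2 := Subspace.finrank_add_finrank_dualAnnihilator_eq (K ∙ S.c)
      rw [hker] at h1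
      omega
  have hmem : f ∈ LinearMap.range ω := by
    rw [hran, Submodule.mem_dualAnnihilator]
    intro y hy
    obtain ⟨t, rfl⟩ := Submodule.mem_span_singleton.1 hy
    simp [hf]
  obtain ⟨w, rfl⟩ := hmem
  refine ⟨w - S.coord w • S.c, S.coord_sub_self w, fun x => ?_⟩
  rw [sub_lie, smul_lie, S.c_lie, smul_zero, sub_zero, hω, ← S.lie_eq]

/-- The Euler derivation, acting as `1` on the kernel of `coord` and as `2` on the center. -/
def euler : LieDerivation K L L where
  toLinearMap := LinearMap.id + S.coord.smulRight S.c
  leibniz' x y := by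
    simp only [LinearMap.add_apply, LinearMap.id_apply, LinearMap.smulRight_apply, lie_add,
      lie_smul, S.lie_c, smul_zero, add_zero, ← S.lie_eq]
    rw [← lie_skew y x, sub_neg_eq_add]

@[simp] lemma euler_apply (x : L) : S.euler x = x + S.coord x • S.c := rfl

lemma euler_of_coord {x : L} (hx : S.coord x = 0) : S.euler x = x := by simp [hx]

/-- Derivations preserve the center. -/
lemma der_c (D : LieDerivation K L L) : D S.c = S.coord (D S.c) • S.c := by
  obtain ⟨x, y, -, -, h⟩ := S.exists_pair
  have : ∃ t : K, D S.c = t • S.c := by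
    rw [← h, LieDerivation.apply_lie_eq_add, h, S.lie_eq x, S.lie_eq (D x), ← add_smul]
    exact ⟨_, rfl⟩
  obtain ⟨t, ht⟩ := this
  rw [ht]
  simp [S.coord_c]

lemma euler_lie_apply (D : LieDerivation K L L) (x : L) :
    ⁅S.euler, D⁆ x = (S.coord (D x) - S.coord x * S.coord (D S.c)) • S.c := by
  rw [LieDerivation.commutator_apply, euler_apply, euler_apply, map_add, map_smul]
  have h := S.der_c D
  generalize S.coord (D S.c) = t at h ⊢
  rw [h]
  module

lemma exists_ad_eq_euler_lie [FiniteDimensional K L] (D : LieDerivation K L L) :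
    ∃ w, S.coord w = 0 ∧ LieDerivation.ad K L w = ⁅S.euler, D⁆ := by
  obtain ⟨w, hw, h⟩ := S.exists_rep (S.coord ∘ₗ D.toLinearMap - S.coord (D S.c) • S.coord)
    (by simp [S.coord_c])
  refine ⟨w, hw, ?_⟩
  ext x
  rw [S.euler_lie_apply, LieDerivation.ad_apply_apply, h]
  simp [mul_comm]

/-- The element `w` of the kernel of `coord` for which `ad w` is the degree one part `⁅euler, D⁆`
of a derivation `D`. -/
noncomputable def degOne [FiniteDimensional K L] : LieDerivation K L L →ₗ[K] L where
  toFun D := (S.exists_ad_eq_euler_lie D).choose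
  map_add' D D' := by
    refine S.eq_of_ad_eq (S.exists_ad_eq_euler_lie _).choose_spec.1 ?_ ?_
    · simp [fun D => (S.exists_ad_eq_euler_lie D).choose_spec.1]
    · rw [(S.exists_ad_eq_euler_lie _).choose_spec.2, map_add]
      simp only [fun D => (S.exists_ad_eq_euler_lie D).choose_spec.2, lie_add]
  map_smul' t D := by
    refine S.eq_of_ad_eq (S.exists_ad_eq_euler_lie _).choose_spec.1 ?_ ?_
    · simp [fun D => (S.exists_ad_eq_euler_lie D).choose_spec.1]
    · rw [(S.exists_ad_eq_euler_lie _).choose_spec.2, map_smul]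
      simp only [fun D => (S.exists_ad_eq_euler_lie D).choose_spec.2, lie_smul, RingHom.id_apply]

lemma coord_degOne [FiniteDimensional K L] (D : LieDerivation K L L) :
    S.coord (S.degOne D) = 0 := (S.exists_ad_eq_euler_lie D).choose_spec.1

lemma ad_degOne [FiniteDimensional K L] (D : LieDerivation K L L) :
    LieDerivation.ad K L (S.degOne D) = ⁅S.euler, D⁆ := (S.exists_ad_eq_euler_lie D).choose_spec.2

lemma euler_lie_ad {x : L} (hx : S.coord x = 0) :
    ⁅S.euler, LieDerivation.ad K L x⁆ = LieDerivation.ad K L x := by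
  rw [LieDerivation.lie_der_ad_eq_ad_der, S.euler_of_coord hx]

lemma euler_lie_euler_lie [FiniteDimensional K L] (D : LieDerivation K L L) :
    ⁅S.euler, ⁅S.euler, D⁆⁆ = ⁅S.euler, D⁆ := by
  rw [← S.ad_degOne D, S.euler_lie_ad (S.coord_degOne D)]

lemma coord_der {D : LieDerivation K L L} (hD : ⁅S.euler, D⁆ = 0) {x : L} (hx : S.coord x = 0) :
    S.coord (D x) = 0 := by
  have h := S.euler_lie_apply D x
  rw [hD, hx, zero_mul, sub_zero, LieDerivation.zero_apply] at h
  exact (smul_eq_zero.1 h.symm).resolve_right S.c_ne_zero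

/-- Derivations that agree on the kernel of `coord`, which generates the algebra, are equal. -/
lemma der_eq_zero {D : LieDerivation K L L} (h : ∀ x, S.coord x = 0 → D x = 0) : D = 0 := by
  have hc : D S.c = 0 := by
    obtain ⟨x, y, hx, hy, h2⟩ := S.exists_pair
    rw [← h2, LieDerivation.apply_lie_eq_add, h x hx, h y hy]
    simp
  ext x
  have := h _ (S.coord_sub_self x)
  rw [map_sub, map_smul, hc] at this
  simpa using this

/-- A map on the kernel of `coord` that scales the symplectic form infinitesimally extends to a
derivation. -/
lemma exists_der (f : L →ₗ[K] L) (μ : K)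
    (hf : ∀ x y, S.coord x = 0 → S.coord y = 0 → ⁅f x, y⁆ + ⁅x, f y⁆ = μ • ⁅x, y⁆) :
    ∃ B : LieDerivation K L L, (∀ x, S.coord x = 0 → B x = f x) ∧ B S.c = μ • S.c := by
  let B : L →ₗ[K] L :=
    f ∘ₗ (LinearMap.id - S.coord.smulRight S.c) + S.coord.smulRight (μ • S.c)
  have hB : ∀ x, B x = f (x - S.coord x • S.c) + S.coord x • μ • S.c := fun x => rfl
  refine ⟨⟨B, fun x y => ?_⟩, fun x hx => (hB x).trans (by simp [hx]),
    (hB S.c).trans (by simp [S.coord_c])⟩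
  have h1 := hf _ _ (S.coord_sub_self x) (S.coord_sub_self y)
  have hbr : ⁅x - S.coord x • S.c, y - S.coord y • S.c⁆ = ⁅x, y⁆ := by
    simp only [sub_lie, lie_sub, smul_lie, lie_smul, S.c_lie, S.lie_c, smul_zero, sub_zero]
  rw [hbr, sub_lie, lie_sub, smul_lie, lie_smul, S.lie_c, S.c_lie, smul_zero, smul_zero,
    sub_zero, sub_zero] at h1
  rw [hB, ← S.lie_eq, sub_self, map_zero, zero_add, smul_comm, ← S.lie_eq, ← h1, hB, hB]
  simp only [lie_add, lie_smul, S.lie_c, smul_zero, add_zero]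
  rw [← lie_skew y]
  abel

/-- The symplectic transvection `x ↦ coord ⁅v, x⁆ • v`, as a derivation of degree zero. -/
def transvection (v : L) : LieDerivation K L L where
  toLinearMap := (S.coord ∘ₗ (LieAlgebra.ad K L v)).smulRight v
  leibniz' x y := by
    simp only [LinearMap.smulRight_apply, LinearMap.comp_apply, LieAlgebra.ad_apply,
      S.lie_lie_right, map_zero, zero_smul, lie_smul]
    rw [← lie_skew x v, ← lie_skew y v, S.lie_eq v x, S.lie_eq v y]
    simp only [map_smul, S.coord_c, smul_eq_mul, mul_one]
    module

@[simp] lemma transvection_apply (v x : L) : S.transvection v x = S.coord ⁅v, x⁆ • v := rfl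

lemma euler_lie_transvection {v : L} (hv : S.coord v = 0) : ⁅S.euler, S.transvection v⁆ = 0 := by
  ext x
  rw [S.euler_lie_apply]
  simp [hv, S.lie_c]

/-- A Schur lemma: an endomorphism whose commutators with all symplectic transvections are
scalar is itself scalar. -/
lemma exists_scalar [CharZero K] (Y : L →ₗ[K] L) (hY : ∀ x, S.coord x = 0 → S.coord (Y x) = 0)
    (h : ∀ v, S.coord v = 0 → ∃ k : K, ∀ x, S.coord x = 0 →
      Y (S.transvection v x) = S.transvection v (Y x) + k • x) :
    ∃ k : K, ∀ x, S.coord x = 0 → Y x = k • x := by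
  have key : ∀ v, S.coord v = 0 → ∃ t : K, Y v = t • v := fun v hv => by
    by_cases hv0 : v = 0
    · exact ⟨0, by simp [hv0]⟩
    obtain ⟨w, hw, hvw⟩ := S.exists_lie_eq_c hv hv0
    obtain ⟨k, hk⟩ := h v hv
    have h1 := hk v hv
    have h2 := hk w hw
    rw [transvection_apply, transvection_apply, hvw, S.coord_c, one_smul] at h2
    -- the commutator is `k`; at `w` this gives `coord ⁅v, Y v⁆ = k`, and at `v` it gives
    -- `coord ⁅v, Y v⁆ = -k`
    have h3 : S.coord ⁅v, Y v⁆ = k := by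
      rw [h2, lie_add, lie_smul, lie_smul, hvw, lie_self]
      simp [S.coord_c]
    rw [transvection_apply, transvection_apply, lie_self, map_zero, zero_smul, map_zero, h3,
      ← add_smul, eq_comm, smul_eq_zero, or_iff_left hv0, ← two_mul, mul_eq_zero,
      or_iff_right two_ne_zero] at h1
    rw [h1, zero_smul, add_zero] at h2
    exact ⟨_, h2⟩
  let Y' : LinearMap.ker S.coord →ₗ[K] LinearMap.ker S.coord :=
    Y.restrict fun x hx => LinearMap.mem_ker.2 (hY x (LinearMap.mem_ker.1 hx))
  obtain ⟨k, hk⟩ := LinearMap.exists_eq_smul_id_of_forall_notLinearIndependent (f := Y')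
    fun v => by
      obtain ⟨t, ht⟩ := key v (LinearMap.mem_ker.1 v.2)
      rw [LinearIndependent.pair_iff]
      intro hli
      have := hli t (-1) (by
        apply Subtype.ext
        simp only [Submodule.coe_add, Submodule.coe_smul, Submodule.coe_zero]
        rw [show ((Y' v : LinearMap.ker S.coord) : L) = Y v from rfl, ht]
        module)
      simpa using this.2
  refine ⟨k, fun x hx => ?_⟩
  have := congrArg (fun f => ((f ⟨x, hx⟩ : LinearMap.ker S.coord) : L)) hk
  exact this

end HeisenbergData

end

/-! ### The grading and the outer derivation of the full graph -/

namespace HeisenbergData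

section

open FullGraph

variable {K : Type*} [Field K] {L : Type*} [LieRing L] [LieAlgebra K L] (S : HeisenbergData K L)

/-- The generic `lie_smul` does not see through the module structure on derivations. -/
lemma der_lie_smul (D D' : LieDerivation K L L) (t : K) : ⁅D, t • D'⁆ = t • ⁅D, D'⁆ := by
  ext x
  simp [smul_sub]

/-- The grading element `(euler, 0)` of the full graph. -/
def gradingElt : FullGraph K L := ⟨0, S.euler⟩

@[simp] lemma left_gradingElt : S.gradingElt.left = 0 := rfl
@[simp] lemma right_gradingElt : S.gradingElt.right = S.euler := rfl

/-- The linear map `(D, x) ↦ (ad x, -2 x)`. -/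
def doublingMap (K : Type*) [Field K] (L : Type*) [LieRing L] [LieAlgebra K L] :
    FullGraph K L →ₗ[K] FullGraph K L where
  toFun u := ⟨-(2 : K) • u.left, LieDerivation.ad K L u.left⟩
  map_add' u v := by
    ext1
    · exact smul_add _ _ _
    · exact map_add _ _ _
  map_smul' t u := by
    ext1
    · exact smul_comm _ _ _
    · exact map_smul _ _ _

lemma left_doublingMap (u : FullGraph K L) : (doublingMap K L u).left = -(2 : K) • u.left := rfl

lemma right_doublingMap (u : FullGraph K L) :
    (doublingMap K L u).right = LieDerivation.ad K L u.left := rfl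

/-- The outer derivation `(D, x) ↦ (ad x, -2 x) + ⁅gradingElt, (D, x)⁆` of the full graph. -/
def outerDer : LieDerivation K (FullGraph K L) (FullGraph K L) :=
  { doublingMap K L with
    leibniz' := fun u v => by
      ext1
      · rw [left_doublingMap, left_lie, left_sub, left_lie, left_lie, left_doublingMap,
          left_doublingMap, right_doublingMap, right_doublingMap]
        simp only [LieDerivation.ad_apply_apply, lie_smul, map_smul]
        rw [← lie_skew u.left v.left]
        module
      · rw [right_doublingMap, left_lie, right_sub, right_lie, right_lie, right_doublingMap,
          right_doublingMap, LieDerivation.lie_der_ad_eq_ad_der,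
          LieDerivation.lie_der_ad_eq_ad_der, map_sub, map_add]
        rw [show LieDerivation.ad K L ⁅u.left, v.left⁆ = 0 by
          ext x
          rw [LieDerivation.ad_apply_apply, S.lie_lie_left, LieDerivation.zero_apply]]
        abel } +
  LieDerivation.ad K _ S.gradingElt

lemma outerDer_apply (u : FullGraph K L) :
    S.outerDer u = doublingMap K L u + ⁅S.gradingElt, u⁆ := by
  rw [← LieDerivation.ad_apply_apply (R := K)]
  rfl

lemma left_outerDer (u : FullGraph K L) :
    (S.outerDer u).left = S.coord u.left • S.c - u.left := by
  rw [outerDer_apply, left_add, left_doublingMap, left_lie]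
  simp only [left_gradingElt, right_gradingElt, zero_lie, map_zero, euler_apply]
  module

lemma right_outerDer (u : FullGraph K L) :
    (S.outerDer u).right = LieDerivation.ad K L u.left + ⁅S.euler, u.right⁆ := by
  rw [outerDer_apply]
  rfl

@[simp] lemma outerDer_gradingElt : S.outerDer S.gradingElt = 0 := by
  ext1
  · rw [left_outerDer]; simp
  · rw [right_outerDer]; simp

lemma left_gradingElt_lie (u : FullGraph K L) : ⁅S.gradingElt, u⁆.left = S.euler u.left := by
  simp

lemma right_gradingElt_lie (u : FullGraph K L) :
    ⁅S.gradingElt, u⁆.right = ⁅S.euler, u.right⁆ := rfl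

section Twisted

variable [FiniteDimensional K L] [CharZero K]
  {d : FullGraph K L →ₗ[K] FullGraph K L} {b : FullGraph K L →ₗ[K] K}

/-- The pair `(d, b)` encodes a derivation `u ↦ ad (d u) + b u • outerDer` of the full graph with
values in the span of the inner derivations and `outerDer`. Since `outerDer` is not inner, the
Leibniz rule splits into one condition on each component. -/
structure IsTwistedDer (d : FullGraph K L →ₗ[K] FullGraph K L) (b : FullGraph K L →ₗ[K] K) :
    Prop where
  apply_lie (u v : FullGraph K L) :
    d ⁅u, v⁆ = ⁅d u, v⁆ + ⁅u, d v⁆ + b u • S.outerDer v - b v • S.outerDer u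
  form_lie (u v : FullGraph K L) : b ⁅u, v⁆ = 0

namespace IsTwistedDer

variable {S}

omit [FiniteDimensional K L] [CharZero K] in
lemma sub_inner (h : S.IsTwistedDer d b) (w : FullGraph K L) (a : K) :
    S.IsTwistedDer (d - LieAlgebra.ad K _ w - a • S.outerDer.toLinearMap) b where
  apply_lie u v := by
    simp only [LinearMap.sub_apply, LinearMap.smul_apply, LieAlgebra.ad_apply, h.apply_lie,
      LieDerivation.coeFn_coe, S.outerDer.apply_lie_eq_add, sub_lie, lie_sub, smul_lie, lie_smul,
      leibniz_lie w u v, smul_add]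
    abel
  form_lie := h.form_lie

omit [CharZero K] in
/-- If `d` maps the grading element into degree zero, then it kills it. -/
lemma apply_gradingElt (h : S.IsTwistedDer d b) (h1 : (d S.gradingElt).left = 0)
    (h2 : ⁅S.euler, (d S.gradingElt).right⁆ = 0) : d S.gradingElt = 0 ∧ b S.gradingElt = 0 := by
  set T := (d S.gradingElt).right with hT
  -- the twisted Leibniz rule for `⁅S.gradingElt, x⁆ = x`, where `x` has degree one
  have hleft : ∀ x : L, ⁅S.gradingElt, leftCopy K x⁆ = leftCopy K (S.euler x) := fun x => by
    rw [lie_leftCopy]; simp [sumHom_apply]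
  have key : ∀ x : L, S.coord x = 0 →
      (d (leftCopy K x)).left = T x + S.euler (d (leftCopy K x)).left - b S.gradingElt • x ∧
      (d (leftCopy K x)).right = ⁅S.euler, (d (leftCopy K x)).right⁆ +
        b S.gradingElt • LieDerivation.ad K L x := fun x hx => by
    have h3 := h.apply_lie S.gradingElt (leftCopy K x)
    rw [hleft, S.euler_of_coord hx, outerDer_gradingElt, smul_zero, sub_zero] at h3
    constructor
    · have := congrArg LieAlgebra.SemiDirectSum.left h3
      rw [left_add, left_add, left_smul, left_outerDer, left_gradingElt_lie, left_lie, ← hT,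
        h1, left_leftCopy, right_leftCopy, hx] at this
      refine this.trans ?_
      simp only [zero_lie, zero_add, LieDerivation.zero_apply, sub_zero, zero_smul, zero_sub]
      module
    · have := congrArg LieAlgebra.SemiDirectSum.right h3
      rw [right_add, right_add, right_smul, right_outerDer, right_gradingElt_lie, right_lie,
        left_leftCopy, right_leftCopy, lie_zero, lie_zero, zero_add, add_zero] at this
      exact this
  -- taking the degree one part of the second identity of `key` isolates its last term
  have hb : b S.gradingElt = 0 := by
    obtain ⟨x, y, hx, -, hxy⟩ := S.exists_pair
    have h3 := congrArg (fun D => ⁅S.euler, D⁆) (key x hx).2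
    simp only [lie_add, der_lie_smul, S.euler_lie_euler_lie, S.euler_lie_ad hx] at h3
    have h4 := LieDerivation.congr_fun (left_eq_add.1 h3) y
    simp only [LieDerivation.smul_apply, LieDerivation.ad_apply_apply, hxy,
      LieDerivation.zero_apply] at h4
    exact (smul_eq_zero.1 h4).resolve_right S.c_ne_zero
  refine ⟨?_, hb⟩
  ext1
  · exact h1
  · refine S.der_eq_zero fun x hx => ?_
    have h3 := (key x hx).1
    rw [hb, zero_smul, sub_zero, euler_apply] at h3
    have h4 := congrArg S.coord h3
    simp only [map_add, map_smul, S.coord_der h2 hx, S.coord_c, smul_eq_mul, mul_one,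
      zero_add, left_eq_add] at h4
    rw [h4, zero_smul, add_zero, right_eq_add] at h3
    exact h3

section Graded

variable (h : S.IsTwistedDer d b) (hd : d S.gradingElt = 0) (hb : b S.gradingElt = 0)
include h hd hb

omit [FiniteDimensional K L] [CharZero K] in
lemma apply_gradingElt_lie (u : FullGraph K L) :
    d ⁅S.gradingElt, u⁆ = ⁅S.gradingElt, d u⁆ := by
  rw [h.apply_lie, hd, hb]
  simp only [outerDer_gradingElt, smul_zero, zero_smul, zero_lie, zero_add, add_zero, sub_zero]

omit [CharZero K] in
/-- `d` preserves the degree one part of the full graph. -/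
lemma apply_degree_one {u : FullGraph K L} (hu : ⁅S.gradingElt, u⁆ = u) :
    S.coord (d u).left = 0 ∧ (d u).right = LieDerivation.ad K L (S.degOne (d u).right) := by
  have h1 := h.apply_gradingElt_lie hd hb u
  rw [hu] at h1
  constructor
  · have := congrArg LieAlgebra.SemiDirectSum.left h1
    rw [left_gradingElt_lie, euler_apply, left_eq_add] at this
    exact (smul_eq_zero.1 this).resolve_right S.c_ne_zero
  · have := congrArg LieAlgebra.SemiDirectSum.right h1
    rw [right_gradingElt_lie] at this
    rw [S.ad_degOne, ← this]

/-- `d` preserves the degree two part of the full graph. -/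
lemma apply_c : d (leftCopy K S.c) = leftCopy K (S.coord (d (leftCopy K S.c)).left • S.c) := by
  have h1 := h.apply_gradingElt_lie hd hb (leftCopy K S.c)
  have h2 : ⁅S.gradingElt, leftCopy K S.c⁆ = (2 : K) • leftCopy K S.c := by
    rw [lie_leftCopy, ← map_smul]
    simp [sumHom_apply, S.coord_c, two_smul]
  rw [h2, map_smul] at h1
  ext1
  · have := congrArg LieAlgebra.SemiDirectSum.left h1
    rw [left_gradingElt_lie, euler_apply, left_smul, two_smul, add_right_inj] at this
    exact this
  · have := congrArg LieAlgebra.SemiDirectSum.right h1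
    rw [right_gradingElt_lie, right_smul] at this
    have h3 := S.euler_lie_euler_lie (d (leftCopy K S.c)).right
    rw [← this, der_lie_smul, ← this, two_smul K ((2 : K) • _), add_eq_right,
      smul_eq_zero, or_iff_right two_ne_zero] at h3
    exact h3

omit [FiniteDimensional K L] in
/-- `d` preserves the degree zero part of the full graph. -/
lemma apply_degree_zero {D : LieDerivation K L L} (hD : ⁅S.euler, D⁆ = 0) :
    (d ⟨0, D⟩).left = 0 ∧ ⁅S.euler, (d ⟨0, D⟩).right⁆ = 0 := by
  have h1 := h.apply_gradingElt_lie hd hb ⟨0, D⟩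
  have h2 : ⁅S.gradingElt, (⟨0, D⟩ : FullGraph K L)⁆ = 0 := by
    ext1
    · simp
    · exact hD
  rw [h2, map_zero] at h1
  constructor
  · have := congrArg LieAlgebra.SemiDirectSum.left h1
    rw [left_gradingElt_lie, euler_apply, left_zero] at this
    have h3 := congrArg S.coord this
    simp only [map_add, map_smul, S.coord_c, smul_eq_mul, mul_one, map_zero, ← two_mul] at h3
    rw [zero_eq_mul, or_iff_right two_ne_zero] at h3
    rw [h3, zero_smul, add_zero] at this
    exact this.symm
  · exact (congrArg LieAlgebra.SemiDirectSum.right h1).symm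

end Graded
end IsTwistedDer
end Twisted

end

end HeisenbergData

/-! ### Twisted derivations of degree zero -/

namespace HeisenbergData

section

open FullGraph

variable {K : Type*} [Field K] {L : Type*} [LieRing L] [LieAlgebra K L] (S : HeisenbergData K L)

variable (K) in
/-- The embedding `x ↦ (ad x, 0)` of `L` modulo its center in the full graph. -/
def adCopy : L →ₗ[K] FullGraph K L where
  toFun x := ⟨0, LieDerivation.ad K L x⟩
  map_add' x y := by
    ext1
    · exact (add_zero _).symm
    · exact map_add _ _ _
  map_smul' t x := by
    ext1
    · exact (smul_zero _).symm
    · exact map_smul _ _ _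

@[simp] lemma left_adCopy (x : L) : (adCopy K x).left = 0 := rfl
@[simp] lemma right_adCopy (x : L) : (adCopy K x).right = LieDerivation.ad K L x := rfl

/-- The inclusion of the derivations in the full graph. -/
def ofDer : LieDerivation K L L →ₗ⁅K⁆ FullGraph K L := LieAlgebra.SemiDirectSum.inr _

@[simp] lemma left_ofDer (D : LieDerivation K L L) : (ofDer D).left = 0 := rfl
@[simp] lemma right_ofDer (D : LieDerivation K L L) : (ofDer D).right = D := rfl

lemma ofDer_lie_leftCopy (D : LieDerivation K L L) (x : L) :
    ⁅ofDer D, leftCopy K x⁆ = leftCopy K (D x) := by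
  rw [lie_leftCopy]; simp [sumHom_apply]

lemma ofDer_lie_adCopy (D : LieDerivation K L L) (x : L) :
    ⁅ofDer D, adCopy K x⁆ = adCopy K (D x) := by
  ext1
  · simp
  · exact LieDerivation.lie_der_ad_eq_ad_der D x

lemma outerDer_leftCopy {x : L} (hx : S.coord x = 0) :
    S.outerDer (leftCopy K x) = adCopy K x - leftCopy K x := by
  ext1
  · rw [left_outerDer]; simp [hx]
  · rw [right_outerDer]; simp

lemma outerDer_c : S.outerDer (leftCopy K S.c) = 0 := by
  ext1
  · rw [left_outerDer]; simp [S.coord_c]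
  · rw [right_outerDer]
    ext x
    simp [S.c_lie]

lemma outerDer_adCopy {x : L} (hx : S.coord x = 0) : S.outerDer (adCopy K x) = adCopy K x := by
  ext1
  · rw [left_outerDer]; simp
  · rw [right_outerDer, left_adCopy, right_adCopy, map_zero, zero_add, S.euler_lie_ad hx]

lemma outerDer_ofDer {D : LieDerivation K L L} (hD : ⁅S.euler, D⁆ = 0) :
    S.outerDer (ofDer D) = 0 := by
  ext1
  · rw [left_outerDer]; simp
  · rw [right_outerDer, left_ofDer, right_ofDer, map_zero, zero_add, hD, right_zero]

lemma gradingElt_lie_leftCopy {x : L} (hx : S.coord x = 0) :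
    ⁅S.gradingElt, leftCopy K x⁆ = leftCopy K x := by
  rw [show S.gradingElt = ofDer S.euler from rfl, ofDer_lie_leftCopy, S.euler_of_coord hx]

lemma gradingElt_lie_adCopy {x : L} (hx : S.coord x = 0) :
    ⁅S.gradingElt, adCopy K x⁆ = adCopy K x := by
  rw [show S.gradingElt = ofDer S.euler from rfl, ofDer_lie_adCopy, S.euler_of_coord hx]

/-- The full graph is spanned by its parts of degrees zero, one and two. -/
lemma linearMap_eq_zero [FiniteDimensional K L] {V : Type*} [AddCommGroup V] [Module K V]
    {f : FullGraph K L →ₗ[K] V}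
    (h0 : ∀ D : LieDerivation K L L, ⁅S.euler, D⁆ = 0 → f (ofDer D) = 0)
    (h1 : ∀ x, S.coord x = 0 → f (leftCopy K x) = 0)
    (h1' : ∀ x, S.coord x = 0 → f (adCopy K x) = 0)
    (h2 : f (leftCopy K S.c) = 0) : f = 0 := by
  ext u
  have hu : u = ofDer (u.right - ⁅S.euler, u.right⁆) + leftCopy K (u.left - S.coord u.left • S.c)
      + adCopy K (S.degOne u.right) + S.coord u.left • leftCopy K S.c := by
    ext1
    · simp
    · simp [S.ad_degOne, -LieDerivation.coe_ad_apply_eq_ad_apply]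
  rw [hu, map_add, map_add, map_add, map_smul, h2, h1 _ (S.coord_sub_self _),
    h1' _ (S.coord_degOne _), h0]
  · simp
  · rw [lie_sub, S.euler_lie_euler_lie, sub_self]

namespace IsTwistedDer

variable {S} [FiniteDimensional K L]
  {d : FullGraph K L →ₗ[K] FullGraph K L} {b : FullGraph K L →ₗ[K] K}
  (h : S.IsTwistedDer d b) (hd : d S.gradingElt = 0) (hb : b S.gradingElt = 0)
include h hd hb

/-- The matrix entries of `d` on the part of degree one. -/
lemma exists_components : ∃ α β γ ε : L →ₗ[K] L, ∀ x, S.coord x = 0 →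
    (S.coord (α x) = 0 ∧ S.coord (β x) = 0 ∧ S.coord (γ x) = 0 ∧ S.coord (ε x) = 0) ∧
    d (leftCopy K x) = leftCopy K (β x) + adCopy K (α x) ∧
    d (adCopy K x) = leftCopy K (ε x) + adCopy K (γ x) := by
  let pl : FullGraph K L →ₗ[K] L := LieAlgebra.SemiDirectSum.projl _
  let pr : FullGraph K L →ₗ[K] L := S.degOne ∘ₗ (LieAlgebra.SemiDirectSum.projr _).toLinearMap
  have hp : ∀ u : FullGraph K L, ⁅S.gradingElt, u⁆ = u → (S.coord (pr (d u)) = 0 ∧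
      S.coord (pl (d u)) = 0) ∧ d u = leftCopy K (pl (d u)) + adCopy K (pr (d u)) := fun u hu => by
    obtain ⟨h1, h2⟩ := h.apply_degree_one hd hb hu
    refine ⟨⟨S.coord_degOne _, h1⟩, ?_⟩
    ext1
    · exact (add_zero _).symm
    · exact h2.trans (zero_add _).symm
  refine ⟨pr ∘ₗ d ∘ₗ (leftCopy K).toLinearMap, pl ∘ₗ d ∘ₗ (leftCopy K).toLinearMap,
    pr ∘ₗ d ∘ₗ adCopy K, pl ∘ₗ d ∘ₗ adCopy K, fun x hx => ?_⟩
  obtain ⟨⟨h1, h2⟩, h3⟩ := hp _ (S.gradingElt_lie_leftCopy hx)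
  obtain ⟨⟨h4, h5⟩, h6⟩ := hp _ (S.gradingElt_lie_adCopy hx)
  exact ⟨⟨h1, h2, h4, h5⟩, h3, h6⟩

variable [CharZero K]

omit [FiniteDimensional K L] in
lemma ofDer_eq {D : LieDerivation K L L} (hD : ⁅S.euler, D⁆ = 0) :
    d (ofDer D) = ofDer (d (ofDer D)).right := by
  ext1
  · exact (h.apply_degree_zero hd hb hD).1
  · rfl

/-- A twisted derivation that kills the grading element is the bracket with some
`(B, 0)`, up to a multiple of `outerDer`. -/
lemma eq_of_apply_gradingElt : b = 0 ∧ ∃ (B : LieDerivation K L L) (a : K),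
    ∀ u, d u = ⁅ofDer B, u⁆ + a • S.outerDer u := by
  obtain ⟨α, β, γ, ε, hcomp⟩ := h.exists_components hd hb
  have hα := fun x hx => (hcomp x hx).1.1
  have hβ := fun x hx => (hcomp x hx).1.2.1
  have hγ := fun x hx => (hcomp x hx).1.2.2.1
  have hε := fun x hx => (hcomp x hx).1.2.2.2
  have hleft := fun x hx => (hcomp x hx).2.1
  have had := fun x hx => (hcomp x hx).2.2
  have left_eq : ∀ {x y x' y' : L}, leftCopy K x + adCopy K y = leftCopy K x' + adCopy K y' →
      x = x' := fun hxy => by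
    simpa using congrArg LieAlgebra.SemiDirectSum.left hxy
  have ad_eq : ∀ {x y x' y' : L}, leftCopy K x + adCopy K y = leftCopy K x' + adCopy K y' →
      S.coord y = 0 → S.coord y' = 0 → y = y' := fun hxy hy hy' => by
    refine S.eq_of_ad_eq hy hy' ?_
    simpa [-LieDerivation.coe_ad_apply_eq_ad_apply] using
      congrArg LieAlgebra.SemiDirectSum.right hxy
  -- equivariance of the matrix entries under the derivations of degree zero
  have equivL : ∀ D : LieDerivation K L L, ⁅S.euler, D⁆ = 0 → ∀ x, S.coord x = 0 →
      β (D x) = (d (ofDer D)).right x + D (β x) - b (ofDer D) • x ∧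
      α (D x) = D (α x) + b (ofDer D) • x := fun D hD x hx => by
    have h1 := h.apply_lie (ofDer D) (leftCopy K x)
    rw [ofDer_lie_leftCopy, hleft _ (S.coord_der hD hx), hleft x hx, lie_add, ofDer_lie_leftCopy,
      ofDer_lie_adCopy, h.ofDer_eq hd hb hD, ofDer_lie_leftCopy, S.outerDer_ofDer hD, smul_zero,
      sub_zero, S.outerDer_leftCopy hx, smul_sub, ← map_smul, ← map_smul] at h1
    have h2 : leftCopy K (β (D x)) + adCopy K (α (D x)) =
        leftCopy K ((d (ofDer D)).right x + D (β x) - b (ofDer D) • x) +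
          adCopy K (D (α x) + b (ofDer D) • x) := by
      rw [h1, map_sub, map_add, map_add]
      abel
    refine ⟨left_eq h2, ad_eq h2 (hα _ (S.coord_der hD hx)) ?_⟩
    rw [map_add, map_smul, hx, S.coord_der hD (hα x hx), smul_zero, add_zero]
  have equivA : ∀ D : LieDerivation K L L, ⁅S.euler, D⁆ = 0 → ∀ x, S.coord x = 0 →
      ε (D x) = D (ε x) ∧
      γ (D x) = (d (ofDer D)).right x + D (γ x) + b (ofDer D) • x := fun D hD x hx => by
    have h1 := h.apply_lie (ofDer D) (adCopy K x)
    rw [ofDer_lie_adCopy, had _ (S.coord_der hD hx), had x hx, lie_add, ofDer_lie_leftCopy,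
      ofDer_lie_adCopy, h.ofDer_eq hd hb hD, ofDer_lie_adCopy, S.outerDer_ofDer hD, smul_zero,
      sub_zero, S.outerDer_adCopy hx, ← map_smul] at h1
    have h2 : leftCopy K (ε (D x)) + adCopy K (γ (D x)) = leftCopy K (D (ε x)) +
        adCopy K ((d (ofDer D)).right x + D (γ x) + b (ofDer D) • x) := by
      rw [h1, map_add (adCopy K), map_add (adCopy K)]
      abel
    have hτ : ⁅S.euler, (d (ofDer D)).right⁆ = 0 := (h.apply_degree_zero hd hb hD).2
    refine ⟨left_eq h2, ad_eq h2 (hγ _ (S.coord_der hD hx)) ?_⟩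
    rw [map_add, map_add, map_smul, hx, S.coord_der hD (hγ x hx), S.coord_der hτ hx,
      smul_zero, add_zero, add_zero]
  obtain ⟨x₀, y₀, hx₀, hy₀, hxy₀⟩ := S.exists_pair
  have hx₀' : x₀ ≠ 0 := fun h0 => S.c_ne_zero (by rw [← hxy₀, h0, zero_lie])
  obtain ⟨a, ha⟩ := S.exists_scalar α hα fun v hv =>
    ⟨_, fun x hx => (equivL _ (S.euler_lie_transvection hv) x hx).2⟩
  have hb0 : ∀ D : LieDerivation K L L, ⁅S.euler, D⁆ = 0 → b (ofDer D) = 0 := fun D hD => by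
    have h1 := (equivL D hD x₀ hx₀).2
    rw [ha _ (S.coord_der hD hx₀), ha _ hx₀, map_smul, left_eq_add, smul_eq_zero,
      or_iff_left hx₀'] at h1
    exact h1
  obtain ⟨e, he⟩ := S.exists_scalar ε hε fun v hv => ⟨0, fun x hx => by
    rw [zero_smul, add_zero]
    exact (equivA _ (S.euler_lie_transvection hv) x hx).1⟩
  obtain ⟨k, hk⟩ := S.exists_scalar (γ - β)
    (fun x hx => by rw [LinearMap.sub_apply, map_sub, hγ x hx, hβ x hx, sub_zero])
    fun v hv => ⟨0, fun x hx => by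
      have hv' := S.euler_lie_transvection hv
      rw [LinearMap.sub_apply, LinearMap.sub_apply, (equivA _ hv' x hx).2, (equivL _ hv' x hx).1,
        hb0 _ hv', map_sub]
      module⟩
  have hγ' : ∀ x, S.coord x = 0 → γ x = β x + k • x := fun x hx => by
    rw [← hk x hx, LinearMap.sub_apply, add_sub_cancel]
  have hbl : ∀ x, S.coord x = 0 → b (leftCopy K x) = 0 := fun x hx => by
    rw [← S.gradingElt_lie_leftCopy hx, h.form_lie]
  have hba : ∀ x, S.coord x = 0 → b (adCopy K x) = 0 := fun x hx => by
    rw [← S.gradingElt_lie_adCopy hx, h.form_lie]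
  have hb' : b = 0 := by
    refine S.linearMap_eq_zero hb0 hbl hba ?_
    rw [← hxy₀, LieHom.map_lie, h.form_lie]
  refine ⟨hb', ?_⟩
  have hder : ∀ u v, d ⁅u, v⁆ = ⁅d u, v⁆ + ⁅u, d v⁆ := fun u v => by
    rw [h.apply_lie, hb']
    simp only [LinearMap.zero_apply, zero_smul, add_zero, sub_zero]
  set μ := S.coord (d (leftCopy K S.c)).left
  have hdc : d (leftCopy K S.c) = leftCopy K (μ • S.c) := h.apply_c hd hb
  have hdlie : ∀ x y : L, d (leftCopy K ⁅x, y⁆) = leftCopy K (μ • ⁅x, y⁆) := fun x y => by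
    rw [S.lie_eq, map_smul, map_smul, hdc, ← map_smul, smul_comm]
  -- the brackets of the elements of degree one, which land in degree two
  have e_zero : e = 0 := by
    have h1 := hder (adCopy K x₀) (adCopy K y₀)
    rw [had _ hx₀, had _ hy₀, he _ hx₀, he _ hy₀] at h1
    have h2 := congrArg LieAlgebra.SemiDirectSum.left h1
    have h3 : ⁅adCopy K x₀, adCopy K y₀⁆ = 0 := by
      ext1
      · simp
      · ext x
        simp [S.lie_lie_right]
    rw [h3, map_zero] at h2
    simp only [left_add, left_lie, left_zero, left_leftCopy, left_adCopy, right_add,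
      right_leftCopy, right_adCopy, map_zero, LieDerivation.ad_apply_apply, lie_zero,
      zero_lie, add_zero, zero_add, sub_zero, zero_sub,
      lie_smul, hxy₀, ← lie_skew y₀ x₀, smul_neg, neg_neg] at h2
    rw [smul_zero, zero_add, ← add_smul, ← two_mul, eq_comm, smul_eq_zero,
      or_iff_left S.c_ne_zero, mul_eq_zero,
      or_iff_right two_ne_zero] at h2
    exact h2
  have rel1 : ∀ x y, S.coord x = 0 → S.coord y = 0 →
      ⁅β x, y⁆ + ⁅x, β y⁆ + k • ⁅x, y⁆ = μ • ⁅x, y⁆ := fun x y hx hy => by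
    have h1 := hder (adCopy K x) (leftCopy K y)
    have h3 : ⁅adCopy K x, leftCopy K y⁆ = leftCopy K ⁅x, y⁆ := by
      rw [lie_leftCopy]; simp [sumHom_apply]
    rw [h3, hdlie, had _ hx, hleft _ hy, he _ hx, e_zero, zero_smul, hγ' _ hx] at h1
    have h2 := congrArg LieAlgebra.SemiDirectSum.left h1
    simp only [left_add, left_lie, left_leftCopy, left_adCopy, right_add,
      right_leftCopy, right_adCopy, map_zero, LieDerivation.ad_apply_apply, zero_lie,
      add_zero, zero_add, sub_zero,
      add_lie, smul_lie] at h2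
    rw [h2]
    abel
  have rel2 : ∀ x y, S.coord x = 0 → S.coord y = 0 →
      ⁅β x, y⁆ + ⁅x, β y⁆ + (2 * a) • ⁅x, y⁆ = μ • ⁅x, y⁆ := fun x y hx hy => by
    have h1 := hder (leftCopy K x) (leftCopy K y)
    rw [← LieHom.map_lie, hdlie, hleft _ hx, hleft _ hy, ha _ hx, ha _ hy] at h1
    have h2 := congrArg LieAlgebra.SemiDirectSum.left h1
    simp only [left_add, left_lie, left_leftCopy, left_adCopy, right_add,
      right_leftCopy, right_adCopy, LieDerivation.zero_apply,
      LieDerivation.ad_apply_apply, add_zero, zero_add, sub_zero,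
      smul_lie, ← lie_skew y x] at h2
    rw [h2]
    module
  have hk2 : k = 2 * a := by
    have h1 := (rel1 x₀ y₀ hx₀ hy₀).trans (rel2 x₀ y₀ hx₀ hy₀).symm
    rw [add_right_inj, hxy₀] at h1
    exact smul_left_injective K S.c_ne_zero h1
  -- the degree zero derivation through which `d` acts, up to the outer derivation
  obtain ⟨B, hB, hBc⟩ := S.exists_der (β + a • LinearMap.id) μ fun x y hx hy => by
    simp only [LinearMap.add_apply, LinearMap.smul_apply, LinearMap.id_apply, add_lie, lie_add,
      smul_lie, lie_smul, ← rel2 x y hx hy]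
    module
  refine ⟨B, a, fun u => ?_⟩
  suffices d - LieAlgebra.ad K _ (ofDer B) - a • S.outerDer.toLinearMap = 0 by
    have := LinearMap.congr_fun this u
    rw [LinearMap.sub_apply, LinearMap.sub_apply, LinearMap.zero_apply, sub_sub,
      sub_eq_zero] at this
    exact this
  have hd'' := h.sub_inner (ofDer B) a
  set d' := d - LieAlgebra.ad K _ (ofDer B) - a • S.outerDer.toLinearMap with hd'
  have hd'_apply : ∀ u, d' u = d u - ⁅ofDer B, u⁆ - a • S.outerDer u := fun u => rfl
  have hl : ∀ x, S.coord x = 0 → d' (leftCopy K x) = 0 := fun x hx => by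
    rw [hd'_apply, hleft x hx, ofDer_lie_leftCopy, hB x hx, S.outerDer_leftCopy hx, ha x hx]
    simp only [LinearMap.add_apply, LinearMap.smul_apply, LinearMap.id_apply, map_add, map_smul]
    module
  have hc : d' (leftCopy K S.c) = 0 := by
    rw [hd'_apply, hdc, ofDer_lie_leftCopy, hBc, S.outerDer_c, sub_self, smul_zero, sub_zero]
  refine S.linearMap_eq_zero (fun D hD => ?_) hl (fun x hx => ?_) hc
  · have h1 : d' (ofDer D) = ofDer ((d (ofDer D)).right - ⁅B, D⁆) := by
      rw [hd'_apply, h.ofDer_eq hd hb hD, S.outerDer_ofDer hD, smul_zero, sub_zero,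
        ← LieHom.map_lie, ← map_sub]
      rfl
    rw [h1, ← map_zero (ofDer : LieDerivation K L L →ₗ⁅K⁆ FullGraph K L)]
    congr 1
    refine S.der_eq_zero fun x hx => ?_
    have h2 := hd''.apply_lie (ofDer D) (leftCopy K x)
    rw [ofDer_lie_leftCopy, hl _ (S.coord_der hD hx), hl x hx, hb', h1, ofDer_lie_leftCopy,
      lie_zero, LinearMap.zero_apply, LinearMap.zero_apply, zero_smul, zero_smul, add_zero,
      add_zero, sub_zero, ← map_zero (leftCopy K : L →ₗ⁅K⁆ FullGraph K L)] at h2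
    exact (leftCopy_injective h2).symm
  · rw [hd'_apply, had x hx, he x hx, e_zero, hγ' x hx, hk2, ofDer_lie_adCopy, hB x hx,
      S.outerDer_adCopy hx]
    simp only [LinearMap.add_apply, LinearMap.smul_apply, LinearMap.id_apply, map_add, map_smul,
      zero_smul, map_zero]
    module

end IsTwistedDer

end

end HeisenbergData

/-! ### Derivations of the first full graph -/

namespace HeisenbergData

section

open FullGraph

variable {K : Type*} [Field K] [CharZero K] {L : Type*} [LieRing L] [LieAlgebra K L]
  (S : HeisenbergData K L)

omit [CharZero K] in
lemma ad_add_smul_lie (D : LieDerivation K L L) (w w' : L) (a a' : K) :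
    ⁅LieDerivation.ad K L w + a • D, LieDerivation.ad K L w' + a' • D⁆ =
      LieDerivation.ad K L (⁅w, w'⁆ + a • D w' - a' • D w) := by
  ext u
  simp only [LieDerivation.commutator_apply, LieDerivation.add_apply, LieDerivation.smul_apply,
    LieDerivation.ad_apply_apply, map_smul, lie_add, sub_lie, add_lie, smul_lie,
    D.apply_lie_eq_add, lie_lie]
  module

/-- Every derivation of the full graph with values in the span of the inner derivations and
`outerDer` is the bracket with an element of that span. -/
lemma IsTwistedDer.exists_eq [FiniteDimensional K L] {S : HeisenbergData K L}
    {d : FullGraph K L →ₗ[K] FullGraph K L} {b : FullGraph K L →ₗ[K] K}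
    (h : S.IsTwistedDer d b) :
    b = 0 ∧ ∃ (w : FullGraph K L) (a : K), ∀ u, d u = ⁅w, u⁆ + a • S.outerDer u := by
  set y := (d S.gradingElt).left with hy
  set T := (d S.gradingElt).right with hT
  -- the bracket with `w` removes the components of degrees one and two of `d S.gradingElt`
  let w : FullGraph K L :=
    ⟨-(y - (S.coord y / 2) • S.c), -LieDerivation.ad K L (S.degOne T)⟩
  have hw := h.sub_inner w 0
  set d' := d - LieAlgebra.ad K _ w - (0 : K) • S.outerDer.toLinearMap with hd'
  have hd'_apply : ∀ u, d' u = d u - ⁅w, u⁆ := fun u => by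
    rw [hd', zero_smul, sub_zero]
    rfl
  have he : d' S.gradingElt = d S.gradingElt + ⁅S.gradingElt, w⁆ := by
    rw [hd'_apply, ← lie_skew, sub_neg_eq_add]
  have h1 : (d' S.gradingElt).left = 0 := by
    rw [he, left_add, left_gradingElt_lie, ← hy, euler_apply]
    simp only [w, map_neg, map_sub, map_smul, S.coord_c, smul_eq_mul, mul_one]
    module
  have h2 : ⁅S.euler, (d' S.gradingElt).right⁆ = 0 := by
    rw [he, right_add, right_gradingElt_lie, ← hT]
    simp only [w, lie_neg, S.ad_degOne, S.euler_lie_euler_lie, lie_add, add_neg_cancel]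
  obtain ⟨h3, h4⟩ := hw.apply_gradingElt h1 h2
  obtain ⟨h5, B, a, h6⟩ := hw.eq_of_apply_gradingElt h3 h4
  refine ⟨h5, w + ofDer B, a, fun u => ?_⟩
  have h7 := h6 u
  rw [hd'_apply, sub_eq_iff_eq_add] at h7
  rw [h7, add_lie]
  abel

lemma eq_zero_of_gradingElt_lie {u : FullGraph K L} (hu : ⁅S.gradingElt, u⁆ = 0) : u.left = 0 := by
  have h1 := congrArg LieAlgebra.SemiDirectSum.left hu
  rw [left_gradingElt_lie, euler_apply, left_zero] at h1
  have h2 := congrArg S.coord h1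
  rw [map_add, map_smul, S.coord_c, smul_eq_mul, mul_one, map_zero, ← two_mul, mul_eq_zero,
    or_iff_right two_ne_zero] at h2
  rwa [h2, zero_smul, add_zero] at h1

include S in
lemma center_fullGraph_eq_bot : LieAlgebra.center K (FullGraph K L) = ⊥ := by
  refine center_eq_bot_iff.2 fun u hu => ?_
  have h1 : u.left = 0 := S.eq_zero_of_gradingElt_lie (by rw [← lie_skew, hu, neg_zero])
  ext1
  · exact h1
  ext x
  have h2 := congrArg LieAlgebra.SemiDirectSum.left (hu (leftCopy K x))
  rw [lie_leftCopy, sumHom_apply, h1, map_zero, add_zero] at h2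
  exact h2

/-- The derivation `outerDer` is outer. -/
lemma eq_zero_of_ad_add_outerDer {w : FullGraph K L} {a : K}
    (h : LieDerivation.ad K _ w + a • S.outerDer = 0) : w = 0 ∧ a = 0 := by
  have h' : ∀ u, ⁅w, u⁆ + a • S.outerDer u = 0 := fun u => by
    simpa [-LieAlgebra.SemiDirectSum.add_eq_mk] using LieDerivation.congr_fun h u
  have hw : w.left = 0 := S.eq_zero_of_gradingElt_lie (by
    have := h' S.gradingElt
    rw [outerDer_gradingElt, smul_zero, add_zero] at this
    rw [← lie_skew, this, neg_zero])
  have ha : a = 0 := by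
    obtain ⟨x, y, hx, -, hxy⟩ := S.exists_pair
    have h1 := congrArg LieAlgebra.SemiDirectSum.right (h' (leftCopy K x))
    rw [S.outerDer_leftCopy hx, right_add, right_lie, right_smul, right_sub, right_leftCopy,
      lie_zero, right_adCopy, sub_zero, zero_add, right_zero] at h1
    have h2 := LieDerivation.congr_fun h1 y
    rw [LieDerivation.smul_apply, LieDerivation.ad_apply_apply, hxy, LieDerivation.zero_apply,
      smul_eq_zero, or_iff_left S.c_ne_zero] at h2
    exact h2
  refine ⟨center_eq_bot_iff.1 S.center_fullGraph_eq_bot w fun u => ?_, ha⟩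
  have := h' u
  rwa [ha, zero_smul, add_zero] at this

/-- `(w, a) ↦ ad w + a • outerDer`. -/
def derMap : FullGraph K L × K →ₗ[K] LieDerivation K (FullGraph K L) (FullGraph K L) :=
  (LieDerivation.ad K (FullGraph K L)).toLinearMap.coprod
    (LinearMap.id.smulRight S.outerDer)

omit [CharZero K] in
lemma derMap_apply (w : FullGraph K L) (a : K) :
    S.derMap (w, a) = LieDerivation.ad K _ w + a • S.outerDer := rfl

variable [FiniteDimensional K L]

lemma derMap_bijective : Function.Bijective S.derMap := by
  constructor
  · rw [injective_iff_map_eq_zero]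
    rintro ⟨w, a⟩ h
    obtain ⟨rfl, rfl⟩ := S.eq_zero_of_ad_add_outerDer h
    rfl
  · intro D
    have hD : S.IsTwistedDer D.toLinearMap 0 :=
      ⟨fun u v => by
        simp only [LinearMap.zero_apply, zero_smul, add_zero, sub_zero]
        exact (D.apply_lie_eq_add u v).trans (add_comm _ _), fun _ _ => rfl⟩
    obtain ⟨-, w, a, h⟩ := hD.exists_eq
    refine ⟨(w, a), ?_⟩
    ext1 u
    rw [derMap_apply, LieDerivation.add_apply, LieDerivation.smul_apply,
      LieDerivation.ad_apply_apply]
    exact (h u).symm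

/-- The inner derivations together with `outerDer` exhaust the derivations of the full graph. -/
noncomputable def derEquiv :
    (FullGraph K L × K) ≃ₗ[K] LieDerivation K (FullGraph K L) (FullGraph K L) :=
  LinearEquiv.ofBijective S.derMap S.derMap_bijective

lemma derEquiv_apply (w : FullGraph K L) (a : K) :
    S.derEquiv (w, a) = LieDerivation.ad K _ w + a • S.outerDer := rfl

include S in
/-- Every derivation `f` of `Der (𝔣 L)` is inner: its restriction to `ad (𝔣 L)` is a twisted
derivation, hence the bracket with some `F`, and `f - ad F` then vanishes because `Der (𝔣 L)` acts
faithfully on `𝔣 L`. -/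
lemma exists_eq_ad_der
    (f : LieDerivation K (LieDerivation K (FullGraph K L) (FullGraph K L))
      (LieDerivation K (FullGraph K L) (FullGraph K L))) :
    ∃ F, f = LieDerivation.ad K _ F := by
  let g : FullGraph K L →ₗ[K] FullGraph K L × K :=
    S.derEquiv.symm.toLinearMap ∘ₗ f.toLinearMap ∘ₗ (LieDerivation.ad K _).toLinearMap
  have hg : ∀ u, f (LieDerivation.ad K _ u) =
      LieDerivation.ad K _ (g u).1 + (g u).2 • S.outerDer := fun u =>
    (S.derEquiv.apply_symm_apply _).symm
  have key : ∀ u v, g ⁅u, v⁆ = (⁅(g u).1, v⁆ + ⁅u, (g v).1⁆ + (g u).2 • S.outerDer v -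
      (g v).2 • S.outerDer u, 0) := fun u v => by
    apply S.derEquiv.injective
    change S.derEquiv (S.derEquiv.symm (f (LieDerivation.ad K _ ⁅u, v⁆))) = _
    have h1 := ad_add_smul_lie S.outerDer u (g v).1 0 (g v).2
    have h2 := ad_add_smul_lie S.outerDer (g u).1 v (g u).2 0
    rw [zero_smul, zero_smul, add_zero, add_zero] at h1
    rw [zero_smul, zero_smul, add_zero, sub_zero] at h2
    rw [LinearEquiv.apply_symm_apply, derEquiv_apply, zero_smul, add_zero, LieHom.map_lie,
      f.apply_lie_eq_add, hg, hg, h1, h2, ← map_add]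
    congr 1
    abel
  have ht : S.IsTwistedDer (LinearMap.fst K _ _ ∘ₗ g) (LinearMap.snd K _ _ ∘ₗ g) :=
    ⟨fun u v => congrArg Prod.fst (key u v), fun u v => congrArg Prod.snd (key u v)⟩
  obtain ⟨h1, w, a, h2⟩ := ht.exists_eq
  set F := LieDerivation.ad K _ w + a • S.outerDer with hF
  have hF' : ∀ u, f (LieDerivation.ad K _ u) = LieDerivation.ad K _ (F u) := fun u => by
    rw [hg, show (g u).2 = 0 from LinearMap.congr_fun h1 u, zero_smul, add_zero,
      show (g u).1 = ⁅w, u⁆ + a • S.outerDer u from h2 u, hF, LieDerivation.add_apply,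
      LieDerivation.smul_apply, LieDerivation.ad_apply_apply]
  refine ⟨F, ?_⟩
  ext1 G
  rw [LieDerivation.ad_apply_apply, ← sub_eq_zero]
  refine der_eq_zero_of_lie_ad S.center_fullGraph_eq_bot fun u => ?_
  have h3 := f.apply_lie_eq_add G (LieDerivation.ad K _ u)
  rw [LieDerivation.lie_der_ad_eq_ad_der, hF', hF', LieDerivation.lie_der_ad_eq_ad_der] at h3
  rw [sub_lie, eq_sub_of_add_eq' h3.symm, LieDerivation.lie_der_ad_eq_ad_der,
    LieDerivation.commutator_apply, map_sub, sub_self]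

include S in
lemma exists_ad_eq_lie (D D' : LieDerivation K (FullGraph K L) (FullGraph K L)) :
    ∃ x, LieDerivation.ad K (FullGraph K L) x = ⁅D, D'⁆ := by
  obtain ⟨⟨w, a⟩, rfl⟩ := S.derEquiv.surjective D
  obtain ⟨⟨w', a'⟩, rfl⟩ := S.derEquiv.surjective D'
  exact ⟨_, (ad_add_smul_lie _ _ _ _ _).symm⟩

include S in
/-- The base of the induction along the iterated full graphs. -/
lemma isAlmostComplete_fullGraph : IsAlmostComplete K (FullGraph K L) where
  finiteDimensional := finrank_eq.1
  center_eq_bot := S.center_fullGraph_eq_bot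
  exists_ad_eq_lie := S.exists_ad_eq_lie
  isComplete_der :=
    have : FiniteDimensional K (FullGraph K L) := finrank_eq.1
    { finiteDimensional := S.derEquiv.finiteDimensional
      center_eq_bot := center_der_eq_bot S.center_fullGraph_eq_bot
      exists_eq_ad := S.exists_eq_ad_der }
  finrank_der := by
    have : FiniteDimensional K (FullGraph K L) := finrank_eq.1
    rw [← S.derEquiv.finrank_eq, Module.finrank_prod, Module.finrank_self]

end

end HeisenbergData

end CompleteLie

theorem theorem3 {K : Type*} [Field K] [CharZero K] {L : Type*} [LieRing L] [LieAlgebra K L]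
    (hL : CompleteLie.IsHeisenberg K L) (n : ℕ) (hn : 1 ≤ n) :
    -- the center of `𝔣ⁿ(L)` is trivial
    LieAlgebra.center K (CompleteLie.IterFullGraph K L n) = ⊥ ∧
    -- `Der(𝔣ⁿ(L)) = 𝔣ⁿ⁻¹(Der(𝔣(L)))` is complete, but `𝔣ⁿ(L)` is not
    Nonempty
      (LieDerivation K (CompleteLie.IterFullGraph K L n) (CompleteLie.IterFullGraph K L n) ≃ₗ⁅K⁆
        CompleteLie.IterFullGraph K
          (LieDerivation K (CompleteLie.FullGraph K L) (CompleteLie.FullGraph K L)) (n - 1)) ∧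
    CompleteLie.IsComplete K
      (LieDerivation K (CompleteLie.IterFullGraph K L n) (CompleteLie.IterFullGraph K L n)) ∧
    ¬ CompleteLie.IsComplete K (CompleteLie.IterFullGraph K L n) ∧
    -- `[Der(𝔣ⁿ(L)), Der(𝔣ⁿ(L))] ⊆ ad(𝔣ⁿ(L))`
    (⁅(⊤ : LieIdeal K (LieDerivation K (CompleteLie.IterFullGraph K L n)
          (CompleteLie.IterFullGraph K L n))),
      (⊤ : LieIdeal K (LieDerivation K (CompleteLie.IterFullGraph K L n)
          (CompleteLie.IterFullGraph K L n)))⁆).toSubmodule ≤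
      (LieDerivation.ad K (CompleteLie.IterFullGraph K L n)).range.toSubmodule ∧
    -- `dim Der(𝔣ⁿ(L)) - dim 𝔣ⁿ(L) = 1`, both dimensions being finite
    FiniteDimensional K (CompleteLie.IterFullGraph K L n) ∧
    Module.finrank K
        (LieDerivation K (CompleteLie.IterFullGraph K L n) (CompleteLie.IterFullGraph K L n)) =
      Module.finrank K (CompleteLie.IterFullGraph K L n) + 1 := by
  obtain ⟨S⟩ := hL.nonempty_data
  have := hL.finiteDimensional
  obtain ⟨n, rfl⟩ := Nat.exists_eq_add_of_le' hn
  obtain ⟨h, e⟩ := S.isAlmostComplete_fullGraph.iterFullGraph n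
  exact ⟨h.center_eq_bot, e, h.isComplete_der, h.not_isComplete, h.lie_top_le_range_ad,
    h.finiteDimensional, h.finrank_der⟩
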